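/- Let $f(z)=P_0(z)e^{Q_0(z)}+\cdots+P_n(z)e^{Q_n(z)}$ be an exponential polynomial, where the $P_j\not\equiv 0$ and $Q_j$ are polynomials with complex coefficients, the $Q_j$ are pairwise different, and $Q_j(0)=0$ for all $j$. Let $q=\max_j\deg Q_j$ be the order of $f$. For $w\in\mathbb{C}$ let $$H_w(z)=\sum_{j\in J_w}P_j(z)e^{Q_j(z)-wz^q},$$ where $J_w$ is the set of all $j$ for which the coefficient of $z^q$ in $Q_j$ equals $w$. Thus $f(z)=\sum_w H_w(z)e^{wz^q}$ (the normalized form of $f$), where $H_0$ denotes the coefficient for $w=0$, so that $H_0\equiv 0$ if every $Q_j$ has degree $q$. Let $W_f=\{\overline{w}: H_w\not\equiv 0\}$ be the set of conjugate leading coefficients, and let $C(\operatorname{co}(W_f))$ be the circumference of its convex hull (the sum of the lengths of the sides of this polygon; twice the length if it is a line segment, and $0$ if it is a point). Let $p$ be an integer with $1\le p\le q$, and suppose that every $H_w$ has order at most $q-p$, i.e. $\deg(Q_j-wz^q)\le q-p$ for all $w$ and all $j\in J_w$. Let $m(r,1/f)$ be the Nevanlinna proximity function of $1/f$ and $N(r,1/f)$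 the integrated counting function of the zeros of $f$, counted with multiplicity. Then, as $r\to\infty$: 1. If $H_0\not\equiv 0$, then $m(r,1/f)=O(r^{q-p}+\log r)$. 2. If one of the $Q_j$ vanishes identically, then $m(r,1/f)=O(\log r)$. 3. In all cases, $$N(r,1/f)=C(\operatorname{co}(W_f))\frac{r^q}{2\pi}+O\left(r^{q-p}+\log r\right).$$ -/

import Mathlib

open Filter Asymptotics Polynomial ComplexConjugate

/-- The data of an exponential polynomial
`f(z) = P₀(z) e^{Q₀(z)} + ⋯ + Pₙ(z) e^{Qₙ(z)}`:
the coefficients `Pⱼ` are polynomials that do not vanish identically, and the exponents `Qⱼ` are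
pairwise different polynomials normalized by `Qⱼ(0) = 0`. -/
structure ExponentialPolynomial (n : ℕ) where
  /-- the polynomial coefficients -/
  P : Fin (n + 1) → ℂ[X]
  /-- the exponents -/
  Q : Fin (n + 1) → ℂ[X]
  P_ne_zero : ∀ j, P j ≠ 0
  Q_injective : Function.Injective Q
  Q_eval_zero : ∀ j, (Q j).eval 0 = 0

namespace ExponentialPolynomial

variable {n : ℕ}

/-- The entire function `f(z) = ∑ⱼ Pⱼ(z) e^{Qⱼ(z)}`. -/
noncomputable def toFun (f : ExponentialPolynomial n) (z : ℂ) : ℂ :=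
  ∑ j, (f.P j).eval z * Complex.exp ((f.Q j).eval z)

/-- The order `q = max deg Qⱼ` of an exponential polynomial. -/
def order (f : ExponentialPolynomial n) : ℕ :=
  Finset.univ.sup fun j => (f.Q j).natDegree

/-- The indices `j` for which the exponent `Qⱼ` has the form `w z^q + (terms of degree < q)`, where
`q` is the order. For `w = 0` these are the indices with `deg Qⱼ < q`. -/
noncomputable def group (f : ExponentialPolynomial n) (w : ℂ) : Finset (Fin (n + 1)) :=
  Finset.univ.filter fun j => (f.Q j).coeff f.order = w

/-- The coefficient `H_w` of `e^{w z^q}` in the normalized form `f(z) = ∑_w H_w(z) e^{w z^q}`,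
obtained by collecting all terms whose exponent has `z^q`-coefficient `w`:
`H_w(z) = ∑ⱼ Pⱼ(z) e^{Qⱼ(z) - w z^q}`, the sum over the indices `j` in the group of `w`.
The coefficient usually denoted by `H₀` is the one for `w = 0`; it is an empty sum if every `Qⱼ`
has degree `q`. -/
noncomputable def H (f : ExponentialPolynomial n) (w : ℂ) (z : ℂ) : ℂ :=
  ∑ j ∈ f.group w, (f.P j).eval z * Complex.exp ((f.Q j - C w * X ^ f.order).eval z)

/-- The order of the exponential polynomial `H_w`: the largest degree of the (pairwise different)
exponents `Qⱼ - w z^q` in it. -/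
noncomputable def orderH (f : ExponentialPolynomial n) (w : ℂ) : ℕ :=
  (f.group w).sup fun j => (f.Q j - C w * X ^ f.order).natDegree

/-- The set `W_f` of the conjugates of the leading coefficients of `f`, that is, of those `w` for
which `e^{w z^q}` occurs in the normalized form with a coefficient `H_w ≢ 0`. In particular
`0 ∈ W_f` exactly if `H₀ ≢ 0`. -/
def W (f : ExponentialPolynomial n) : Set ℂ :=
  conj '' {w : ℂ | f.H w ≠ 0}

/-- The normalized form of an exponential polynomial. -/
theorem toFun_eq_sum_H (f : ExponentialPolynomial n) (z : ℂ) :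
    f.toFun z = ∑ w ∈ Finset.univ.image (fun j => (f.Q j).coeff f.order),
      f.H w z * Complex.exp (w * z ^ f.order) := by
  have h : ∀ w, f.H w z * Complex.exp (w * z ^ f.order) =
      ∑ j ∈ Finset.univ.filter (fun j => (f.Q j).coeff f.order = w),
        (f.P j).eval z * Complex.exp ((f.Q j).eval z) := by
    intro w
    rw [H, Finset.sum_mul]
    refine Finset.sum_congr rfl fun j _ => ?_
    rw [mul_assoc, ← Complex.exp_add]
    simp
  simp only [h]
  exact (Finset.sum_fiberwise_of_maps_to
    (fun j _ => Finset.mem_image_of_mem _ (Finset.mem_univ j)) _).symm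

theorem finite_W (f : ExponentialPolynomial n) : f.W.Finite := by
  refine Set.Finite.image _ ((Set.finite_range fun j => (f.Q j).coeff f.order).subset ?_)
  intro w hw
  by_contra hne
  refine hw (funext fun z => Finset.sum_eq_zero fun j hj => ?_)
  exact absurd ⟨j, (Finset.mem_filter.mp hj).2⟩ hne

end ExponentialPolynomial

/-- The sides of a convex polygon `K`, each given by its ordered pair of end points: the ordered
pairs `(a, b)` of distinct vertices (extreme points) of `K` such that all of `K` lies in the closed
half-plane to the left of the line directed from `a` to `b`, so that `a, b` are consecutive vertices
in counterclockwise order. A line segment `[a, b]` is a polygon with the two sides `(a, b)` and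
`(b, a)`; a single point has no sides. -/
def polygonSides (K : Set ℂ) : Set (ℂ × ℂ) :=
  {e | e.1 ∈ K.extremePoints ℝ ∧ e.2 ∈ K.extremePoints ℝ ∧ e.1 ≠ e.2 ∧
    ∀ x ∈ K, 0 ≤ (conj (e.2 - e.1) * (x - e.1)).im}

/-- The convex hull of a finite set has finitely many sides. -/
theorem finite_polygonSides {G : Set ℂ} (hG : G.Finite) :
    (polygonSides (convexHull ℝ G)).Finite :=
  (hG.prod hG).subset fun _ he =>
    ⟨extremePoints_convexHull_subset he.1, extremePoints_convexHull_subset he.2.1⟩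

/-- The circumference of a convex polygon: the sum of the lengths of its sides. The circumference of
a line segment is twice its length, and that of a point is `0`. -/
noncomputable def circumference (K : Set ℂ) : ℝ :=
  ∑ᶠ e ∈ polygonSides K, dist e.1 e.2

/-! Put `M = max_j Re Q_j`. The core is that the circle mean of `max 0 (M - log |f|)` is `O(log r)`
(`exists_circleAverage_maxRe_sub_log_le`). Together with the trivial bound `log |f| ≤ M + O(log r)`
off the zeros, the means of `log |f|` and `M` agree up to `O(log r)`, and Jensen's formula turns the
former into `N(r, 1/f)`. If `M ≥ -D` on the circle with `D ≥ 0`, then `log⁺ (1/|f|) ≤ max 0 (M - log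
|f|) + D`. An exponent of degree at most `q - p` gives `D = O(r^(q-p))`, a vanishing one gives `D =
0`.

For the core estimate, consider `t ↦ f(r e^{it})`. Its derivatives are exponential sums with the
same exponents. Elimination over `ℂ[X]` recovers a nonzero polynomial multiple of each `e^{Q_i}`
from them (`exists_single_mem_rotDerivSpan`). Hence at every point of a large circle some derivative
of bounded order is at least `r^{-K} e^M`. On short arcs it stays nearly constant, so a sublevel
estimate shows that `|f| < r^{-K} e^M η^K` holds only on a set of measure at most `r^{K+1} η`.
Integrating this exponential tail leaves a logarithm.

Finally, up to `O(r^{q-p})`, `M` is `r^q` times the support function of `W_f` in direction `qt`. Its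
mean is the circumference over `2π` by Cauchy's formula, which follows by integrating the width
identity `sum_polygonSides_eq_width` over all directions. -/

/-! ### Sublevel sets and exponential tails. -/

open MeasureTheory in
/-- A real function whose `k`-th derivative is at least `c > 0` on an order connected set is small
only on a small part of that set. The derivatives are `u 0, u 1, …`. -/
theorem volume_sublevel_le_of_le_deriv (k : ℕ) :
    ∀ (u : ℕ → ℝ → ℝ), (∀ i t, HasDerivAt (u i) (u (i + 1) t) t) →
    ∀ (S : Set ℝ), S.OrdConnected → ∀ c : ℝ, 0 < c → (∀ t ∈ S, c ≤ u k t) → ∀ η : ℝ, 0 < η →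
      volume {t | t ∈ S ∧ |u 0 t| < c * η ^ k} ≤ ENNReal.ofReal (3 ^ (k + 1) * η) := by
  induction k with
  | zero =>
    intro u _ S _ c _ h η _
    have : {t | t ∈ S ∧ |u 0 t| < c * η ^ 0} = ∅ := by
      ext t
      simp only [pow_zero, mul_one, Set.mem_ofPred_eq, Set.mem_empty_iff_false, iff_false, not_and,
        not_lt]
      exact fun ht => (h t ht).trans (le_abs_self _)
    rw [this, measure_empty]
    exact zero_le
  | succ k ih =>
    intro u hu S hS c hc h η hη
    have hmono : ∀ s ∈ S, ∀ t ∈ S, s ≤ t → c * (t - s) ≤ u k t - u k s := by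
      intro s hs t ht hst
      rcases hst.eq_or_lt with rfl | hst
      · simp
      obtain ⟨x, hx, hxe⟩ := exists_hasDerivAt_eq_slope (u k) (u (k + 1)) hst
        (fun x _ => (hu k x).continuousAt.continuousWithinAt) (fun x _ => hu k x)
      have h1 := h x (hS.out hs ht ⟨hx.1.le, hx.2.le⟩)
      rwa [hxe, le_div_iff₀ (by linarith)] at h1
    -- Since `u k` grows with slope at least `c`, the middle set `D` has diameter at most `2η`. The
    -- sets `A` and `B` are order connected, and induction applies on them with `cη` in place of
    -- `c`.
    set A := {t | t ∈ S ∧ c * η ≤ u k t} with hA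
    set B := {t | t ∈ S ∧ c * η ≤ -u k t} with hB
    set D := {t | t ∈ S ∧ |u k t| < c * η} with hD
    have hAo : A.OrdConnected := by
      refine ⟨fun s hs t ht x hx => ⟨hS.out hs.1 ht.1 hx, ?_⟩⟩
      have h1 := hmono s hs.1 x (hS.out hs.1 ht.1 hx) hx.1
      have h2 : 0 ≤ c * (x - s) := mul_nonneg hc.le (by linarith [hx.1])
      linarith [hs.2]
    have hBo : B.OrdConnected := by
      refine ⟨fun s hs t ht x hx => ⟨hS.out hs.1 ht.1 hx, ?_⟩⟩
      have h1 := hmono x (hS.out hs.1 ht.1 hx) t ht.1 hx.2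
      have h2 : 0 ≤ c * (t - x) := mul_nonneg hc.le (by linarith [hx.2])
      linarith [ht.2]
    have hDv : volume D ≤ ENNReal.ofReal (2 * η) := by
      refine (Real.volume_le_diam D).trans (Metric.ediam_le_of_forall_dist_le ?_)
      have key : ∀ s ∈ D, ∀ t ∈ D, s ≤ t → t - s ≤ 2 * η := by
        intro s hs t ht hst
        have h1 := hmono s hs.1 t ht.1 hst
        have h2 := abs_lt.1 hs.2
        have h3 := abs_lt.1 ht.2
        have : c * (t - s) ≤ c * (2 * η) := by linarith
        exact le_of_mul_le_mul_left this hc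
      intro s hs t ht
      rw [Real.dist_eq, abs_le]
      rcases le_total s t with hst | hst
      · have := key s hs t ht hst
        constructor <;> linarith
      · have := key t ht s hs hst
        constructor <;> linarith
    have hAv := ih u hu A hAo (c * η) (by positivity) (fun t ht => ht.2) η hη
    have hBv := ih (fun i t => -u i t) (fun i t => (hu i t).neg) B hBo (c * η) (by positivity)
      (fun t ht => ht.2) η hη
    have hsub : {t | t ∈ S ∧ |u 0 t| < c * η ^ (k + 1)} ⊆
        ({t | t ∈ A ∧ |u 0 t| < c * η * η ^ k} ∪ {t | t ∈ B ∧ |-u 0 t| < c * η * η ^ k}) ∪ D := by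
      rintro t ⟨ht, hut⟩
      have hut' : |u 0 t| < c * η * η ^ k := by rwa [mul_assoc, ← pow_succ']
      by_cases h1 : |u k t| < c * η
      · exact Or.inr ⟨ht, h1⟩
      · rcases le_abs.1 (not_lt.1 h1) with h2 | h2
        · exact Or.inl (Or.inl ⟨⟨ht, h2⟩, hut'⟩)
        · exact Or.inl (Or.inr ⟨⟨ht, h2⟩, by rwa [abs_neg]⟩)
    calc volume {t | t ∈ S ∧ |u 0 t| < c * η ^ (k + 1)}
        ≤ (ENNReal.ofReal (3 ^ (k + 1) * η) + ENNReal.ofReal (3 ^ (k + 1) * η)) +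
          ENNReal.ofReal (2 * η) :=
          (measure_mono hsub).trans ((measure_union_le _ _).trans
            (add_le_add ((measure_union_le _ _).trans (add_le_add hAv hBv)) hDv))
      _ = ENNReal.ofReal (3 ^ (k + 1) * η + 3 ^ (k + 1) * η + 2 * η) := by
          rw [ENNReal.ofReal_add (by positivity) (by positivity),
            ENNReal.ofReal_add (by positivity) (by positivity)]
      _ ≤ ENNReal.ofReal (3 ^ (k + 1 + 1) * η) := by
          refine ENNReal.ofReal_le_ofReal ?_
          have : (1 : ℝ) ≤ 3 ^ k := one_le_pow₀ (by norm_num)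
          have h9 : (3 : ℝ) ^ (k + 1 + 1) = 9 * 3 ^ k := by ring
          have h3 : (3 : ℝ) ^ (k + 1) = 3 * 3 ^ k := by ring
          rw [h9, h3]
          nlinarith

/-- The complex form of `volume_sublevel_le_of_le_deriv`. -/
theorem volume_sublevel_le_of_norm_sub_le (k : ℕ) (φ : ℕ → ℝ → ℂ)
    (hφ : ∀ i t, HasDerivAt (φ i) (φ (i + 1) t) t) (S : Set ℝ) (hS : S.OrdConnected) (v : ℂ) (c : ℝ)
    (hc : 0 < c) (hv : 2 * c ≤ ‖v‖) (h : ∀ t ∈ S, ‖φ k t - v‖ ≤ c) (η : ℝ) (hη : 0 < η) :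
    MeasureTheory.volume {t | t ∈ S ∧ ‖φ 0 t‖ < c * η ^ k} ≤
      ENNReal.ofReal (3 ^ (k + 1) * η) := by
  have hv0 : (0 : ℝ) < ‖v‖ := by linarith
  -- Multiplication by the unit `w` turns `v` into `‖v‖`, so the real part of `w * φ k` is at least
  -- `2c - c` on `S`.
  set w : ℂ := conj v / ‖v‖ with hw
  have hw1 : ‖w‖ = 1 := by
    rw [hw, norm_div, RCLike.norm_conj, Complex.norm_real, norm_norm, div_self hv0.ne']
  have hwv : (w * v).re = ‖v‖ := by
    rw [hw, div_mul_eq_mul_div, mul_comm, Complex.mul_conj, Complex.normSq_eq_norm_sq,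
      ← Complex.ofReal_div, Complex.ofReal_re]
    field_simp
  have hder : ∀ i t, HasDerivAt (fun t => (w * φ i t).re) ((w * φ (i + 1) t).re) t :=
    fun i t => Complex.reCLM.hasFDerivAt.comp_hasDerivAt t ((hφ i t).const_mul w)
  refine (MeasureTheory.measure_mono ?_).trans
    (volume_sublevel_le_of_le_deriv k (fun i t => (w * φ i t).re) hder S hS c hc ?_ η hη)
  · rintro t ⟨ht, hlt⟩
    refine ⟨ht, lt_of_le_of_lt ((Complex.abs_re_le_norm _).trans ?_) hlt⟩
    rw [norm_mul, hw1, one_mul]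
  · intro t ht
    have h1 : (w * φ k t).re = ‖v‖ + (w * (φ k t - v)).re := by
      rw [← hwv, ← Complex.add_re]; ring_nf
    have h2 : |(w * (φ k t - v)).re| ≤ c := by
      refine (Complex.abs_re_le_norm _).trans ?_
      rw [norm_mul, hw1, one_mul]
      exact h t ht
    have := (abs_le.1 h2).1
    linarith

open MeasureTheory in
/-- A nonnegative function with exponentially decaying distribution function has an integral that
is controlled by the logarithm of the constant. -/
theorem integral_le_of_measure_lt_le_exp {α : Type*} [MeasurableSpace α] (μ : Measure α)
    (g : α → ℝ) (hg : Measurable g) (hg0 : ∀ x, 0 ≤ g x) (V K m : ℝ) (hV : 0 ≤ V) (hK : 1 ≤ K)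
    (hm : 0 < m) (hμ : μ Set.univ ≤ ENNReal.ofReal V)
    (h : ∀ l : ℝ, 0 < l → μ {x | l < g x} ≤ ENNReal.ofReal (K * Real.exp (-l / m))) :
    Integrable g μ ∧ ∫ x, g x ∂μ ≤ V * (m * Real.log K) + m := by
  have hlog : 0 ≤ Real.log K := Real.log_nonneg hK
  -- At `s` the tail bound `K e^{-l/m}` equals `1`. Below `s` the total mass is used, above `s` the
  -- tail integrates to `m`.
  set s := m * Real.log K with hs
  have hs0 : 0 ≤ s := by positivity
  have hneg : -(1 / m) < 0 := by simpa using hm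
  have hbound : ∫⁻ x, ENNReal.ofReal (g x) ∂μ ≤ ENNReal.ofReal (V * s + m) := by
    rw [lintegral_eq_lintegral_meas_lt μ (Eventually.of_forall hg0) hg.aemeasurable,
      ← Set.Ioc_union_Ioi_eq_Ioi hs0, ENNReal.ofReal_add (by positivity) hm.le]
    refine (lintegral_union_le _ _ _).trans (add_le_add ?_ ?_)
    · calc ∫⁻ t in Set.Ioc 0 s, μ {x | t < g x}
          ≤ ∫⁻ _ in Set.Ioc 0 s, ENNReal.ofReal V :=
            lintegral_mono fun t => (measure_mono (Set.subset_univ _)).trans hμ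
        _ = ENNReal.ofReal (V * s) := by
            rw [setLIntegral_const, Real.volume_Ioc, sub_zero, ENNReal.ofReal_mul hV]
    · calc ∫⁻ t in Set.Ioi s, μ {x | t < g x}
          ≤ ∫⁻ t in Set.Ioi s, ENNReal.ofReal (K * Real.exp (-(1 / m) * t)) := by
            refine setLIntegral_mono' measurableSet_Ioi fun t ht => ?_
            refine (h t (hs0.trans_lt ht)).trans_eq ?_
            congr 3
            field_simp
        _ = ENNReal.ofReal (∫ t in Set.Ioi s, K * Real.exp (-(1 / m) * t)) := by
            rw [ofReal_integral_eq_lintegral_ofReal]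
            · exact (integrableOn_exp_mul_Ioi hneg s).const_mul K
            · exact Eventually.of_forall fun t => by positivity
        _ = ENNReal.ofReal m := by
            rw [integral_const_mul, integral_exp_mul_Ioi hneg]
            congr 1
            have : -(1 / m) * s = -Real.log K := by rw [hs]; field_simp
            rw [this, Real.exp_neg, Real.exp_log (by linarith)]
            field_simp
  have hint : Integrable g μ := by
    refine ⟨hg.aestronglyMeasurable, ?_⟩
    rw [hasFiniteIntegral_iff_ofReal (Eventually.of_forall hg0)]
    exact hbound.trans_lt ENNReal.ofReal_lt_top
  refine ⟨hint, ?_⟩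
  rw [integral_eq_lintegral_of_nonneg_ae (Eventually.of_forall hg0) hg.aestronglyMeasurable]
  exact ENNReal.toReal_le_of_le_ofReal (by positivity) hbound

/-! ### Elimination among the rotational derivatives. -/

section ExpSum

variable {ι : Type*}

/-- The coefficients of the derivative of `∑ⱼ Aⱼ(z) e^{Qⱼ(z)}` at `z = r e^{it}` with respect
to `t`. -/
noncomputable def rotDeriv (Q A : ι → ℂ[X]) : ι → ℂ[X] :=
  fun j => C Complex.I * (X * derivative (A j) + A j * (X * derivative (Q j)))

/-- The exponential sum `∑ⱼ Aⱼ(z) e^{Qⱼ(z)}`. -/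
noncomputable def expSum [Fintype ι] (Q A : ι → ℂ[X]) (z : ℂ) : ℂ :=
  ∑ j, (A j).eval z * Complex.exp ((Q j).eval z)

theorem hasDerivAt_eval_circleMap (p : ℂ[X]) (r t : ℝ) :
    HasDerivAt (fun t => p.eval (circleMap 0 r t))
      ((derivative p).eval (circleMap 0 r t) * (circleMap 0 r t * Complex.I)) t :=
  (p.hasDerivAt (circleMap 0 r t)).comp t (hasDerivAt_circleMap 0 r t)

theorem hasDerivAt_expSum_circleMap [Fintype ι] (Q A : ι → ℂ[X]) (r t : ℝ) :
    HasDerivAt (fun t => expSum Q A (circleMap 0 r t))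
      (expSum Q (rotDeriv Q A) (circleMap 0 r t)) t := by
  refine HasDerivAt.fun_sum fun j _ => ?_
  refine ((hasDerivAt_eval_circleMap (A j) r t).mul
    (hasDerivAt_eval_circleMap (Q j) r t).cexp).congr_deriv ?_
  simp only [rotDeriv, eval_mul, eval_add, eval_C, eval_X]
  ring

theorem natDegree_X_mul_derivative_le (p : ℂ[X]) :
    (X * derivative p).natDegree ≤ p.natDegree := by
  by_cases h : p.natDegree = 0
  · rw [natDegree_eq_zero.1 h |>.choose_spec.symm]; simp
  · have h1 := natDegree_mul_le (p := (X : ℂ[X])) (q := derivative p)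
    have h2 := natDegree_derivative_lt h
    rw [natDegree_X] at h1
    omega

theorem natDegree_X_mul_derivative (p : ℂ[X]) (hp : 1 ≤ p.natDegree) :
    (X * derivative p).natDegree = p.natDegree := by
  refine le_antisymm (natDegree_X_mul_derivative_le p) (le_natDegree_of_ne_zero ?_)
  obtain ⟨d, hd⟩ := Nat.exists_eq_add_of_le' hp
  have hp0 : p ≠ 0 := by rintro rfl; simp at hp
  rw [hd, coeff_X_mul, coeff_derivative, ← hd, coeff_natDegree]
  exact mul_ne_zero (leadingCoeff_ne_zero.2 hp0) (by exact_mod_cast d.succ_ne_zero)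

/-- With the derivation `δ = X d/dX`, the expression `A δB - B δA + A B δD` vanishes only if `D` is
constant or one of `A`, `B` is zero. -/
theorem mul_X_derivative_sub_add_ne_zero {A B D : ℂ[X]} (hA : A ≠ 0) (hB : B ≠ 0)
    (hD : 1 ≤ D.natDegree) :
    A * (X * derivative B) - B * (X * derivative A) + A * B * (X * derivative D) ≠ 0 := by
  intro h
  have hXD : X * derivative D ≠ 0 := by
    intro h0
    have := natDegree_X_mul_derivative D hD
    rw [h0, natDegree_zero] at this
    omega
  -- Degrees decide: the other two products have degree at most `deg A + deg B`.
  have h1 : (A * B * (X * derivative D)).natDegree = A.natDegree + B.natDegree + D.natDegree := by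
    rw [natDegree_mul (mul_ne_zero hA hB) hXD, natDegree_mul hA hB,
      natDegree_X_mul_derivative D hD]
  rw [add_comm, add_eq_zero_iff_eq_neg] at h
  rw [h, natDegree_neg] at h1
  have h2 := natDegree_sub_le (A * (X * derivative B)) (B * (X * derivative A))
  have h3 := natDegree_mul_le (p := A) (q := X * derivative B)
  have h4 := natDegree_mul_le (p := B) (q := X * derivative A)
  have h5 := natDegree_X_mul_derivative_le A
  have h6 := natDegree_X_mul_derivative_le B
  have h7 : max (A * (X * derivative B)).natDegree (B * (X * derivative A)).natDegree ≤
      A.natDegree + B.natDegree := max_le (by omega) (by omega)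
  omega

theorem rotDeriv_add (Q A B : ι → ℂ[X]) : rotDeriv Q (A + B) = rotDeriv Q A + rotDeriv Q B := by
  funext j
  simp only [rotDeriv, Pi.add_apply, derivative_add]
  ring

theorem rotDeriv_smul (Q A : ι → ℂ[X]) (p : ℂ[X]) :
    rotDeriv Q (p • A) = p • rotDeriv Q A + (C Complex.I * (X * derivative p)) • A := by
  funext j
  simp only [rotDeriv, Pi.add_apply, Pi.smul_apply, smul_eq_mul, derivative_mul]
  ring

/-- The `ℂ[X]`-module generated by the iterated derivatives. -/
noncomputable def rotDerivSpan (Q A : ι → ℂ[X]) : Submodule ℂ[X] (ι → ℂ[X]) :=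
  Submodule.span ℂ[X] (Set.range fun k : ℕ => (rotDeriv Q)^[k] A)

theorem self_mem_rotDerivSpan (Q A : ι → ℂ[X]) : A ∈ rotDerivSpan Q A :=
  Submodule.subset_span ⟨0, rfl⟩

/-- `rotDeriv` is not `ℂ[X]`-linear, but the Leibniz rule `rotDeriv_smul` produces only an extra
multiple of the same vector. -/
theorem rotDeriv_mem_rotDerivSpan (Q A : ι → ℂ[X]) {B : ι → ℂ[X]} (hB : B ∈ rotDerivSpan Q A) :
    rotDeriv Q B ∈ rotDerivSpan Q A := by
  refine Submodule.span_induction (p := fun B _ => rotDeriv Q B ∈ rotDerivSpan Q A)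
    ?_ ?_ ?_ ?_ hB
  · rintro _ ⟨k, rfl⟩
    exact Submodule.subset_span ⟨k + 1, Function.iterate_succ_apply' _ _ _⟩
  · have : rotDeriv Q (0 : ι → ℂ[X]) = 0 := by funext j; simp [rotDeriv]
    rw [this]
    exact zero_mem _
  · intro B B' _ _ h h'
    rw [rotDeriv_add]
    exact add_mem h h'
  · intro p B hB h
    rw [rotDeriv_smul]
    exact add_mem (Submodule.smul_mem _ _ h) (Submodule.smul_mem _ _ hB)

theorem rotDerivSpan_le (Q A : ι → ℂ[X]) {B : ι → ℂ[X]} (hB : B ∈ rotDerivSpan Q A) :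
    rotDerivSpan Q B ≤ rotDerivSpan Q A := by
  refine Submodule.span_le.2 ?_
  rintro _ ⟨k, rfl⟩
  induction k with
  | zero => exact hB
  | succ k ih =>
    simp only [Function.iterate_succ_apply']
    exact rotDeriv_mem_rotDerivSpan Q A ih

/-- If the exponents differ by nonconstant polynomials, a multiple of each single exponential is a
combination of the derivatives of the exponential sum. -/
theorem exists_single_mem_rotDerivSpan [DecidableEq ι] (Q : ι → ℂ[X])
    (hQ : ∀ i j, i ≠ j → 1 ≤ (Q i - Q j).natDegree) (i : ι) (s : Finset ι) (hi : i ∉ s) :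
    ∀ A : ι → ℂ[X], (∀ j, j ≠ i → j ∉ s → A j = 0) → A i ≠ 0 →
      ∃ R : ℂ[X], R ≠ 0 ∧ Pi.single i R ∈ rotDerivSpan Q A := by
  induction s using Finset.induction_on with
  | empty =>
    intro A hA hAi
    refine ⟨A i, hAi, ?_⟩
    have : Pi.single i (A i) = A := by
      funext j
      by_cases h : j = i
      · subst h; simp
      · rw [Pi.single_eq_of_ne h, hA j h (Finset.notMem_empty j)]
    rw [this]
    exact self_mem_rotDerivSpan Q A
  | insert m s hm ih =>
    intro A hA hAi
    have hi' : i ∉ s := fun h => hi (Finset.mem_insert_of_mem h)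
    have him : i ≠ m := fun h => hi (h ▸ Finset.mem_insert_self m s)
    by_cases hAm : A m = 0
    · refine ih hi' A (fun j hji hjs => ?_) hAi
      by_cases h : j = m
      · rw [h, hAm]
      · exact hA j hji (by simp [h, hjs])
    -- This combination cancels the component `m`, while the component `i` stays nonzero because `Q
    -- i - Q m` is nonconstant.
    set B : ι → ℂ[X] := A m • rotDeriv Q A - rotDeriv Q A m • A with hB
    have hBmem : B ∈ rotDerivSpan Q A :=
      sub_mem (Submodule.smul_mem _ _ (rotDeriv_mem_rotDerivSpan Q A (self_mem_rotDerivSpan Q A)))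
        (Submodule.smul_mem _ _ (self_mem_rotDerivSpan Q A))
    have hBj : ∀ j, B j = C Complex.I * (A m * (X * derivative (A j)) -
        A j * (X * derivative (A m)) + A m * A j * (X * derivative (Q j - Q m))) := by
      intro j
      simp only [hB, rotDeriv, Pi.sub_apply, Pi.smul_apply, smul_eq_mul, derivative_sub]
      ring
    have hB0 : ∀ j, j ≠ i → j ∉ s → B j = 0 := by
      intro j hji hjs
      rw [hBj]
      by_cases h : j = m
      · subst h
        ring_nf
        simp
      · rw [hA j hji (by simp [h, hjs])]
        simp
    have hBi : B i ≠ 0 := by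
      rw [hBj]
      exact mul_ne_zero (C_ne_zero.2 Complex.I_ne_zero)
        (mul_X_derivative_sub_add_ne_zero hAm hAi (hQ i m him))
    obtain ⟨R, hR, hmem⟩ := ih hi' B hB0 hBi
    exact ⟨R, hR, rotDerivSpan_le Q A hBmem hmem⟩

theorem expSum_smul [Fintype ι] (Q A : ι → ℂ[X]) (p : ℂ[X]) (z : ℂ) :
    expSum Q (p • A) z = p.eval z * expSum Q A z := by
  simp only [expSum, Pi.smul_apply, smul_eq_mul, eval_mul, Finset.mul_sum, mul_assoc]

theorem expSum_sum [Fintype ι] {κ : Type*} (Q : ι → ℂ[X]) (s : Finset κ) (A : κ → ι → ℂ[X])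
    (z : ℂ) : expSum Q (∑ k ∈ s, A k) z = ∑ k ∈ s, expSum Q (A k) z := by
  simp only [expSum, Finset.sum_apply, eval_finsetSum, Finset.sum_mul]
  exact Finset.sum_comm

theorem expSum_single [Fintype ι] [DecidableEq ι] (Q : ι → ℂ[X]) (i : ι) (R : ℂ[X]) (z : ℂ) :
    expSum Q (Pi.single i R) z = R.eval z * Complex.exp ((Q i).eval z) := by
  rw [expSum, Finset.sum_eq_single i]
  · simp
  · intro j _ hj
    simp [Pi.single_eq_of_ne hj]
  · simp

/-- A single exponential in terms of the derivatives of an exponential sum. -/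
theorem exists_eval_mul_exp_eq [Fintype ι] (Q A : ι → ℂ[X])
    (hQ : ∀ i j, i ≠ j → 1 ≤ (Q i - Q j).natDegree) (i : ι) (hA : A i ≠ 0) :
    ∃ R : ℂ[X], R ≠ 0 ∧ ∃ b : ℕ →₀ ℂ[X], ∀ z, R.eval z * Complex.exp ((Q i).eval z) =
      ∑ k ∈ b.support, (b k).eval z * expSum Q ((rotDeriv Q)^[k] A) z := by
  classical
  obtain ⟨R, hR, hmem⟩ := exists_single_mem_rotDerivSpan Q hQ i (Finset.univ.erase i) (by simp) A
    (fun j hji hj => absurd (Finset.mem_erase.2 ⟨hji, Finset.mem_univ j⟩) hj) hA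
  obtain ⟨b, hb⟩ := Finsupp.mem_span_range_iff_exists_finsupp.1 hmem
  refine ⟨R, hR, b, fun z => ?_⟩
  rw [← expSum_single, ← hb, Finsupp.sum, expSum_sum]
  exact Finset.sum_congr rfl fun k _ => expSum_smul _ _ _ _

/-- Exponential sums with nonzero coefficients, whose exponents differ by nonconstant polynomials,
do not vanish identically. -/
theorem expSum_ne_zero [Fintype ι] (Q A : ι → ℂ[X])
    (hQ : ∀ i j, i ≠ j → 1 ≤ (Q i - Q j).natDegree) (i : ι) (hA : A i ≠ 0) : expSum Q A ≠ 0 := by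
  intro h
  obtain ⟨R, hR, b, hb⟩ := exists_eval_mul_exp_eq Q A hQ i hA
  -- If the sum vanishes identically, so do its derivatives along every circle, and then `R e^{Q_i}`
  -- vanishes everywhere.
  have hk : ∀ k r t, expSum Q ((rotDeriv Q)^[k] A) (circleMap 0 r t) = 0 := by
    intro k
    induction k with
    | zero => intro r t; exact congrFun h _
    | succ k ih =>
      intro r t
      have h1 := hasDerivAt_expSum_circleMap Q ((rotDeriv Q)^[k] A) r t
      rw [funext (ih r), ← Function.iterate_succ_apply' (rotDeriv Q)] at h1
      exact h1.unique (hasDerivAt_const t 0)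
  refine hR (Polynomial.funext fun z => ?_)
  have h2 := hb z
  rw [Finset.sum_eq_zero] at h2
  · simpa using h2
  · intro k _
    have := hk k ‖z‖ z.arg
    rw [circleMap, zero_add, Complex.norm_mul_exp_arg_mul_I] at this
    rw [this, mul_zero]

end ExpSum

/-! ### Polynomial bounds on large circles. -/

/-- Lets finitely many power bounds share one exponent and one range of `r`. -/
theorem exists_nat_forall_eventually {ι : Type*} [Finite ι] (p : ι → ℕ → ℝ → Prop)
    (hmono : ∀ i K K' r, 1 ≤ r → K ≤ K' → p i K r → p i K' r)
    (h : ∀ i, ∃ K, ∀ᶠ r in atTop, p i K r) : ∃ K, ∀ᶠ r in atTop, ∀ i, p i K r := by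
  cases nonempty_fintype ι
  choose K hK using h
  refine ⟨Finset.univ.sup K, ?_⟩
  filter_upwards [eventually_all.2 hK, eventually_ge_atTop 1] with r hr h1 i
  exact hmono i _ _ r h1 (Finset.le_sup (Finset.mem_univ i)) (hr i)

theorem exists_norm_eval_le (p : ℂ[X]) :
    ∃ B : ℝ, 0 ≤ B ∧ ∀ z : ℂ, 1 ≤ ‖z‖ → ‖p.eval z‖ ≤ B * ‖z‖ ^ p.natDegree := by
  refine ⟨∑ i ∈ Finset.range (p.natDegree + 1), ‖p.coeff i‖, by positivity, fun z hz => ?_⟩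
  rw [eval_eq_sum_range, Finset.sum_mul]
  refine norm_sum_le_of_le _ fun i hi => ?_
  rw [norm_mul, norm_pow]
  have : i ≤ p.natDegree := Nat.lt_succ_iff.1 (Finset.mem_range.1 hi)
  gcongr

theorem exists_norm_eval_le_pow (p : ℂ[X]) :
    ∃ K : ℕ, ∀ᶠ r : ℝ in atTop, ∀ z : ℂ, ‖z‖ = r → ‖p.eval z‖ ≤ r ^ K := by
  obtain ⟨B, _, hB⟩ := exists_norm_eval_le p
  refine ⟨p.natDegree + 1, ?_⟩
  filter_upwards [eventually_ge_atTop 1, eventually_ge_atTop B] with r h1 hr z hz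
  subst hz
  refine (hB z h1).trans ?_
  rw [pow_succ']
  gcongr

/-- A nonzero polynomial is bounded away from zero near infinity, so a single factor `r` already
suffices. -/
theorem exists_one_le_pow_mul_norm_eval {p : ℂ[X]} (hp : p ≠ 0) :
    ∃ K : ℕ, ∀ᶠ r : ℝ in atTop, ∀ z : ℂ, ‖z‖ = r → 1 ≤ r ^ K * ‖p.eval z‖ := by
  have key : ∃ c > 0, ∀ᶠ r : ℝ in atTop, ∀ z : ℂ, ‖z‖ = r → c ≤ ‖p.eval z‖ := by
    rcases (Nat.zero_le p.natDegree).eq_or_lt' with h | h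
    · rw [eq_C_of_natDegree_eq_zero h] at hp ⊢
      refine ⟨‖p.coeff 0‖, norm_pos_iff.2 (by simpa using hp), ?_⟩
      simp
    · refine ⟨1, one_pos, ?_⟩
      have h1 := p.tendsto_norm_atTop (natDegree_pos_iff_degree_pos.1 h)
        (l := comap (norm : ℂ → ℝ) atTop) tendsto_comap
      exact eventually_comap.1 (h1.eventually_ge_atTop 1)
  obtain ⟨c, hc, h⟩ := key
  refine ⟨1, ?_⟩
  filter_upwards [h, eventually_ge_atTop c⁻¹] with r hr hrc z hz
  rw [pow_one, ← inv_mul_cancel₀ hc.ne']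
  have := hr z hz
  exact mul_le_mul hrc this hc.le ((inv_pos.2 hc).le.trans hrc)

/-! ### Lower bounds for exponential sums off small sets. -/

section ExpSum

variable {ι : Type*} [Fintype ι]

theorem continuous_expSum (Q A : ι → ℂ[X]) : Continuous (expSum Q A) :=
  continuous_finsetSum _ fun j _ => (A j).continuous.mul (Q j).continuous.cexp

variable [Nonempty ι]

/-- The largest real part of the exponents. -/
noncomputable def maxRe (Q : ι → ℂ[X]) (z : ℂ) : ℝ :=
  Finset.univ.sup' Finset.univ_nonempty fun j => ((Q j).eval z).re

theorem le_maxRe (Q : ι → ℂ[X]) (j : ι) (z : ℂ) : ((Q j).eval z).re ≤ maxRe Q z :=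
  Finset.le_sup' (fun j => ((Q j).eval z).re) (Finset.mem_univ j)

theorem exists_eq_maxRe (Q : ι → ℂ[X]) (z : ℂ) : ∃ j, maxRe Q z = ((Q j).eval z).re := by
  obtain ⟨j, _, hj⟩ := Finset.exists_mem_eq_sup' (Finset.univ_nonempty (α := ι))
    fun j => ((Q j).eval z).re
  exact ⟨j, hj⟩

theorem continuous_maxRe (Q : ι → ℂ[X]) : Continuous (maxRe Q) :=
  Continuous.finset_sup'_apply _ fun j _ => Complex.continuous_re.comp (Q j).continuous

theorem exists_norm_expSum_le (Q A : ι → ℂ[X]) :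
    ∃ K : ℕ, ∀ᶠ r : ℝ in atTop, ∀ z : ℂ, ‖z‖ = r →
      ‖expSum Q A z‖ ≤ r ^ K * Real.exp (maxRe Q z) := by
  obtain ⟨K, hK⟩ := exists_nat_forall_eventually
    (fun (j : ι) K r => ∀ z : ℂ, ‖z‖ = r → ‖(A j).eval z‖ ≤ r ^ K)
    (fun j K K' r hr hKK h z hz => (h z hz).trans (pow_le_pow_right₀ hr hKK))
    (fun j => exists_norm_eval_le_pow (A j))
  refine ⟨K + 1, ?_⟩
  filter_upwards [hK, eventually_ge_atTop 1, eventually_ge_atTop (Fintype.card ι : ℝ)]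
    with r hr h1 hc z hz
  calc ‖expSum Q A z‖ ≤ ∑ _j : ι, r ^ K * Real.exp (maxRe Q z) := by
        refine norm_sum_le_of_le _ fun j _ => ?_
        rw [norm_mul, Complex.norm_exp]
        gcongr
        · exact hr j z hz
        · exact le_maxRe Q j z
    _ = Fintype.card ι * (r ^ K * Real.exp (maxRe Q z)) := by
        rw [Finset.sum_const, nsmul_eq_mul, Finset.card_univ]
    _ ≤ r ^ (K + 1) * Real.exp (maxRe Q z) := by
        rw [pow_succ', mul_assoc]
        gcongr

/-- Take the exponent attaining the maximum. The elimination identity writes `R e^{Q_i}` through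
finitely many derivatives with polynomial coefficients, so they cannot all be small where `R` is
not. -/
theorem exists_exp_maxRe_le (Q A : ι → ℂ[X]) (hQ : ∀ i j, i ≠ j → 1 ≤ (Q i - Q j).natDegree)
    (hA : ∀ j, A j ≠ 0) :
    ∃ K : ℕ, ∀ᶠ r : ℝ in atTop, ∀ z : ℂ, ‖z‖ = r →
      ∃ k ≤ K, Real.exp (maxRe Q z) ≤ r ^ K * ‖expSum Q ((rotDeriv Q)^[k] A) z‖ := by
  suffices h : ∃ K, ∀ᶠ r : ℝ in atTop, ∀ i : ι, ∀ z : ℂ, ‖z‖ = r → ∃ k ≤ K,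
      Real.exp ((Q i).eval z).re ≤ r ^ K * ‖expSum Q ((rotDeriv Q)^[k] A) z‖ by
    obtain ⟨K, hK⟩ := h
    refine ⟨K, hK.mono fun r hr z hz => ?_⟩
    obtain ⟨i, hi⟩ := exists_eq_maxRe Q z
    rw [hi]
    exact hr i z hz
  refine exists_nat_forall_eventually _ ?_ ?_
  · intro i K K' r hr hKK h z hz
    obtain ⟨k, hk, hle⟩ := h z hz
    exact ⟨k, hk.trans hKK, hle.trans (by gcongr)⟩
  · intro i
    obtain ⟨R, hR, b, hb⟩ := exists_eval_mul_exp_eq Q A hQ i (hA i)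
    obtain ⟨K₁, hK₁⟩ := exists_one_le_pow_mul_norm_eval hR
    obtain ⟨K₂, hK₂⟩ := exists_nat_forall_eventually
      (fun (k : b.support) K r => ∀ z : ℂ, ‖z‖ = r → ‖(b k).eval z‖ ≤ r ^ K)
      (fun j K K' r hr hKK h z hz => (h z hz).trans (pow_le_pow_right₀ hr hKK))
      (fun k => exists_norm_eval_le_pow (b k))
    -- `K₁` pays for `R`, `K₂` for the coefficients, `1` for the number of terms. The last summand
    -- makes `K` bound the orders of the derivatives.
    refine ⟨K₁ + K₂ + 1 + b.support.sup id, ?_⟩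
    filter_upwards [hK₁, hK₂, eventually_ge_atTop 1,
      eventually_ge_atTop ((b.support.card : ℝ) + 1)] with r h₁ h₂ h1 hc z hz
    by_contra! hcon
    set E := Real.exp ((Q i).eval z).re with hE
    set K := K₁ + K₂ + 1 + b.support.sup id with hKdef
    have hE0 : 0 < E := Real.exp_pos _
    have hr0 : 0 < r := by linarith
    have hterm : ∀ k ∈ b.support,
        r ^ (K₁ + K₂ + 1) * ‖expSum Q ((rotDeriv Q)^[k] A) z‖ ≤ E := by
      intro k hk
      have hk1 : k ≤ b.support.sup id := Finset.le_sup (f := id) hk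
      refine le_trans ?_ (hcon k (by omega)).le
      gcongr
      · omega
    have hsum : r * E ≤ b.support.card * E := by
      calc r * E ≤ r * (r ^ K₁ * ‖R.eval z‖ * E) := by
            have := h₁ z hz
            gcongr
            exact le_mul_of_one_le_left hE0.le this
        _ = r * r ^ K₁ * ‖R.eval z * Complex.exp ((Q i).eval z)‖ := by
            rw [norm_mul, Complex.norm_exp]; ring
        _ ≤ r * r ^ K₁ * ∑ k ∈ b.support, r ^ K₂ * ‖expSum Q ((rotDeriv Q)^[k] A) z‖ := by
            rw [hb z]
            gcongr
            refine norm_sum_le_of_le _ fun k hk => ?_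
            rw [norm_mul]
            gcongr
            exact h₂ ⟨k, hk⟩ z hz
        _ = ∑ k ∈ b.support, r ^ (K₁ + K₂ + 1) * ‖expSum Q ((rotDeriv Q)^[k] A) z‖ := by
            rw [Finset.mul_sum]
            refine Finset.sum_congr rfl fun k _ => ?_
            ring
        _ ≤ ∑ k ∈ b.support, E := Finset.sum_le_sum hterm
        _ = b.support.card * E := by rw [Finset.sum_const, nsmul_eq_mul]
    have := le_of_mul_le_mul_right hsum hE0
    linarith

/-- The exponents have polynomially bounded derivatives along the circle. On short arcs `e^M` may
thus be replaced by its value at one point, at the cost of a factor `e`. -/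
theorem exists_maxRe_circleMap_le (Q : ι → ℂ[X]) :
    ∃ K : ℕ, ∀ᶠ r : ℝ in atTop, ∀ s t : ℝ, |s - t| ≤ (r ^ K)⁻¹ →
      maxRe Q (circleMap 0 r s) ≤ maxRe Q (circleMap 0 r t) + 1 := by
  obtain ⟨K, hK⟩ := exists_nat_forall_eventually
    (fun (j : ι) K r => ∀ z : ℂ, ‖z‖ = r → ‖(derivative (Q j)).eval z‖ ≤ r ^ K)
    (fun j K K' r hr hKK h z hz => (h z hz).trans (pow_le_pow_right₀ hr hKK))
    (fun j => exists_norm_eval_le_pow _)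
  refine ⟨K + 1, ?_⟩
  filter_upwards [hK, eventually_ge_atTop 1] with r hr h1 s t hst
  have hr0 : 0 < r := by linarith
  obtain ⟨j, hj⟩ := exists_eq_maxRe Q (circleMap 0 r s)
  have hdiff : ‖(Q j).eval (circleMap 0 r s) - (Q j).eval (circleMap 0 r t)‖ ≤
      r ^ (K + 1) * ‖s - t‖ := by
    refine convex_univ.norm_image_sub_le_of_norm_hasDerivWithin_le
      (f := fun t => (Q j).eval (circleMap 0 r t))
      (fun x _ => (hasDerivAt_eval_circleMap (Q j) r x).hasDerivWithinAt) (fun x _ => ?_)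
      (Set.mem_univ t) (Set.mem_univ s)
    have hn : ‖circleMap 0 r x‖ = r := by rw [norm_circleMap_zero, abs_of_pos hr0]
    rw [norm_mul, norm_mul, Complex.norm_I, mul_one, hn, pow_succ]
    gcongr
    exact hr j _ hn
  have h2 : r ^ (K + 1) * ‖s - t‖ ≤ 1 := by
    rw [Real.norm_eq_abs]
    calc r ^ (K + 1) * |s - t| ≤ r ^ (K + 1) * (r ^ (K + 1))⁻¹ := by gcongr
      _ = 1 := mul_inv_cancel₀ (by positivity)
  have h3 := (Complex.re_le_norm ((Q j).eval (circleMap 0 r s) - (Q j).eval (circleMap 0 r t)))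
  rw [Complex.sub_re] at h3
  have h4 := le_maxRe Q j (circleMap 0 r t)
  linarith

/-- At the left end of the arc some derivative of order `k ≤ K₁` is large. The next derivative is at
most `r^{K₂} e^{M+1}` with `M` taken at that end, so the `k`-th one changes by at most half its
lower bound along the arc and the sublevel estimate applies. -/
theorem exists_volume_expSum_lt_le (Q A : ι → ℂ[X])
    (hQ : ∀ i j, i ≠ j → 1 ≤ (Q i - Q j).natDegree) (hA : ∀ j, A j ≠ 0) :
    ∃ K : ℕ, 1 ≤ K ∧ ∀ᶠ r : ℝ in atTop, ∀ t₀ η : ℝ, 0 < η → η ≤ 1 →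
      MeasureTheory.volume {t | t ∈ Set.Icc t₀ (t₀ + (r ^ K)⁻¹) ∧ ‖expSum Q A (circleMap 0 r t)‖ <
        (r ^ K)⁻¹ * Real.exp (maxRe Q (circleMap 0 r t)) * η ^ K} ≤
        ENNReal.ofReal (3 ^ (K + 1) * η) := by
  obtain ⟨K₁, hK₁⟩ := exists_exp_maxRe_le Q A hQ hA
  obtain ⟨K₂, hK₂⟩ := exists_nat_forall_eventually
    -- Orders up to `K₁ + 1` are needed, since the variation of the `k`-th derivative is controlled
    -- by the next one.
    (fun (k : Fin (K₁ + 2)) K r => ∀ z : ℂ, ‖z‖ = r →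
      ‖expSum Q ((rotDeriv Q)^[k] A) z‖ ≤ r ^ K * Real.exp (maxRe Q z))
    (fun j K K' r hr hKK h z hz => (h z hz).trans (by gcongr))
    (fun k => exists_norm_expSum_le Q _)
  obtain ⟨K₃, hK₃⟩ := exists_maxRe_circleMap_le Q
  refine ⟨K₁ + K₂ + K₃ + 1, by omega, ?_⟩
  filter_upwards [hK₁, hK₂, hK₃, eventually_ge_atTop (2 * Real.exp 1), eventually_ge_atTop 1]
    with r h₁ h₂ h₃ he h1 t₀ η hη0 hη1
  set K := K₁ + K₂ + K₃ + 1 with hK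
  have hr0 : 0 < r := by linarith
  have hn : ∀ t, ‖circleMap 0 r t‖ = r := fun t => by rw [norm_circleMap_zero, abs_of_pos hr0]
  obtain ⟨k, hk, hle⟩ := h₁ (circleMap 0 r t₀) (hn t₀)
  set E := Real.exp (maxRe Q (circleMap 0 r t₀)) with hE
  have hE0 : 0 < E := Real.exp_pos _
  have hEt : ∀ t ∈ Set.Icc t₀ (t₀ + (r ^ K)⁻¹),
      Real.exp (maxRe Q (circleMap 0 r t)) ≤ Real.exp 1 * E := by
    intro t ht
    rw [hE, ← Real.exp_add, add_comm]
    refine Real.exp_le_exp.2 (h₃ t t₀ ?_)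
    rw [abs_of_nonneg (by linarith [ht.1])]
    calc t - t₀ ≤ (r ^ K)⁻¹ := by linarith [ht.2]
      _ ≤ (r ^ K₃)⁻¹ := by
        gcongr
        · omega
  set c := (r ^ K₁)⁻¹ * E / 2 with hc
  have hc0 : 0 < c := by positivity
  -- Used with `a = 0` for the sublevel threshold and with `a = K₂` for the variation. The spare
  -- factor `r` absorbs `2e`.
  have hpow : ∀ a, a + K₁ + 1 ≤ K → (r ^ K)⁻¹ * (r ^ a * (Real.exp 1 * E)) ≤ c := by
    intro a ha
    have e1 : 2 * Real.exp 1 * (r ^ a * r ^ K₁) ≤ r ^ K := by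
      calc 2 * Real.exp 1 * (r ^ a * r ^ K₁) ≤ r * (r ^ a * r ^ K₁) := by gcongr
        _ = r ^ (a + K₁ + 1) := by ring
        _ ≤ r ^ K := pow_le_pow_right₀ h1 ha
    rw [hc, inv_mul_le_iff₀ (by positivity)]
    calc r ^ a * (Real.exp 1 * E)
        = 2 * Real.exp 1 * (r ^ a * r ^ K₁) * ((r ^ K₁)⁻¹ * E / 2) := by
          field_simp
      _ ≤ r ^ K * ((r ^ K₁)⁻¹ * E / 2) := by gcongr
  have hmain := volume_sublevel_le_of_norm_sub_le k
    (fun k t => expSum Q ((rotDeriv Q)^[k] A) (circleMap 0 r t))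
    (fun i t => by
      simp only [Function.iterate_succ_apply']
      exact hasDerivAt_expSum_circleMap Q _ r t)
    (Set.Icc t₀ (t₀ + (r ^ K)⁻¹)) Set.ordConnected_Icc
    (expSum Q ((rotDeriv Q)^[k] A) (circleMap 0 r t₀)) c hc0 ?_ ?_ η hη0
  · refine (MeasureTheory.measure_mono ?_).trans (hmain.trans (ENNReal.ofReal_le_ofReal ?_))
    · rintro t ⟨ht, hlt⟩
      refine ⟨ht, hlt.trans_le ?_⟩
      have e2 := hpow 0 (by omega)
      rw [pow_zero, one_mul] at e2
      have e3 : η ^ K ≤ η ^ k := pow_le_pow_of_le_one hη0.le hη1 (by omega)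
      gcongr
      refine le_trans ?_ e2
      gcongr
      exact hEt t ht
    · gcongr
      · norm_num
      · omega
  · rw [hc, mul_div_cancel₀ _ two_ne_zero, inv_mul_le_iff₀ (by positivity)]
    exact hle
  · intro t ht
    have hb : ‖expSum Q ((rotDeriv Q)^[k] A) (circleMap 0 r t) -
        expSum Q ((rotDeriv Q)^[k] A) (circleMap 0 r t₀)‖ ≤
        r ^ K₂ * (Real.exp 1 * E) * ‖t - t₀‖ := by
      refine (convex_Icc t₀ (t₀ + (r ^ K)⁻¹)).norm_image_sub_le_of_norm_hasDerivWithin_le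
        (f := fun t => expSum Q ((rotDeriv Q)^[k] A) (circleMap 0 r t))
        (fun x _ => (hasDerivAt_expSum_circleMap Q _ r x).hasDerivWithinAt) (fun x hx => ?_)
        ⟨le_rfl, by simp [hr0.le]⟩ ht
      have e4 := h₂ ⟨k + 1, by omega⟩ (circleMap 0 r x) (hn x)
      simp only [Function.iterate_succ_apply'] at e4
      refine e4.trans ?_
      gcongr
      exact hEt x hx
    refine hb.trans (le_trans ?_ (hpow K₂ (by omega)))
    rw [mul_comm]
    gcongr
    rw [Real.norm_eq_abs, abs_of_nonneg (by linarith [ht.1])]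
    linarith [ht.2]

open MeasureTheory in
-- The circle is covered by `O(r^K)` arcs of length `r^{-K}`. The numerical constants go into one
-- more factor `r`.
theorem exists_volume_Ioc_expSum_lt_le (Q A : ι → ℂ[X])
    (hQ : ∀ i j, i ≠ j → 1 ≤ (Q i - Q j).natDegree) (hA : ∀ j, A j ≠ 0) :
    ∃ K : ℕ, 1 ≤ K ∧ ∀ᶠ r : ℝ in atTop, ∀ η : ℝ, 0 < η → η ≤ 1 →
      volume.restrict (Set.Ioc 0 (2 * Real.pi)) {t | ‖expSum Q A (circleMap 0 r t)‖ <
        (r ^ K)⁻¹ * Real.exp (maxRe Q (circleMap 0 r t)) * η ^ K} ≤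
        ENNReal.ofReal (r ^ (K + 1) * η) := by
  obtain ⟨K, hK1, hK⟩ := exists_volume_expSum_lt_le Q A hQ hA
  refine ⟨K, hK1, ?_⟩
  filter_upwards [hK, eventually_ge_atTop 1, eventually_ge_atTop (9 * 3 ^ (K + 1))]
    with r hr h1 h9 η hη0 hη1
  set δ := (r ^ K)⁻¹ with hδ
  have hr0 : 0 < r := by linarith
  have hδ0 : 0 < δ := by positivity
  set s := {t | ‖expSum Q A (circleMap 0 r t)‖ <
        δ * Real.exp (maxRe Q (circleMap 0 r t)) * η ^ K} with hs
  set N := ⌊2 * Real.pi / δ⌋₊ + 1 with hN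
  have hsub : s ∩ Set.Ioc 0 (2 * Real.pi) ⊆
      ⋃ i ∈ Finset.range N, {t | t ∈ Set.Icc (i * δ) (i * δ + δ) ∧
        ‖expSum Q A (circleMap 0 r t)‖ <
        δ * Real.exp (maxRe Q (circleMap 0 r t)) * η ^ K} := by
    rintro t ⟨hts, ht0, ht⟩
    simp only [Set.mem_iUnion, Finset.mem_range]
    refine ⟨⌊t / δ⌋₊, ?_, ⟨?_, ?_⟩, hts⟩
    · exact Nat.lt_succ_of_le (Nat.floor_le_floor (by gcongr))
    · rw [← le_div_iff₀ hδ0]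
      exact Nat.floor_le (by positivity)
    · have := (Nat.lt_floor_add_one (t / δ)).le
      rw [div_le_iff₀ hδ0] at this
      linarith
  have hNle : (N : ℝ) ≤ 9 * r ^ K := by
    have h2 : (⌊2 * Real.pi / δ⌋₊ : ℝ) ≤ 2 * Real.pi / δ := Nat.floor_le (by positivity)
    have h3 : 2 * Real.pi / δ = 2 * Real.pi * r ^ K := by rw [hδ, div_inv_eq_mul]
    have h4 : 1 ≤ r ^ K := one_le_pow₀ h1
    rw [hN]
    push_cast
    nlinarith [Real.pi_lt_four]
  have hmeas : MeasurableSet s := by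
    have hf := (continuous_expSum Q A).comp (continuous_circleMap 0 r)
    have hm := (continuous_maxRe Q).comp (continuous_circleMap 0 r)
    exact measurableSet_lt hf.norm.measurable
      ((hm.rexp.measurable.const_mul δ).mul_const _)
  rw [Measure.restrict_apply hmeas]
  calc volume (s ∩ Set.Ioc 0 (2 * Real.pi))
      ≤ ∑ i ∈ Finset.range N, ENNReal.ofReal (3 ^ (K + 1) * η) :=
        (measure_mono hsub).trans ((measure_biUnion_finset_le _ _).trans
          (Finset.sum_le_sum fun i _ => hr (i * δ) η hη0 hη1))
    _ = ENNReal.ofReal (N * (3 ^ (K + 1) * η)) := by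
        rw [Finset.sum_const, Finset.card_range, nsmul_eq_mul,
          ENNReal.ofReal_mul (Nat.cast_nonneg _), ENNReal.ofReal_natCast]
    _ ≤ ENNReal.ofReal (r ^ (K + 1) * η) := by
        refine ENNReal.ofReal_le_ofReal ?_
        calc N * (3 ^ (K + 1) * η) ≤ 9 * r ^ K * (3 ^ (K + 1) * η) := by gcongr
          _ = 9 * 3 ^ (K + 1) * r ^ K * η := by ring
          _ ≤ r * r ^ K * η := by gcongr
          _ = r ^ (K + 1) * η := by ring

/-- The positive part of `max Re Qⱼ - log |f|` has circle averages of logarithmic growth. -/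
theorem exists_circleAverage_maxRe_sub_log_le (Q A : ι → ℂ[X])
    (hQ : ∀ i j, i ≠ j → 1 ≤ (Q i - Q j).natDegree) (hA : ∀ j, A j ≠ 0) :
    ∃ B : ℝ, ∀ᶠ r : ℝ in atTop,
      CircleIntegrable (fun z => max 0 (maxRe Q z - Real.log ‖expSum Q A z‖)) 0 r ∧
      Real.circleAverage (fun z => max 0 (maxRe Q z - Real.log ‖expSum Q A z‖)) 0 r ≤
        B * Real.log r := by
  obtain ⟨K, hK1, hK⟩ := exists_volume_Ioc_expSum_lt_le Q A hQ hA
  have hK0 : (0 : ℝ) < K := by exact_mod_cast hK1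
  refine ⟨(2 * Real.pi)⁻¹ * (2 * Real.pi * (K * (K + 1)) + K) + K, ?_⟩
  filter_upwards [hK, eventually_ge_atTop (Real.exp 1)] with r hr he
  have h1 : 1 ≤ r := (Real.one_le_exp zero_le_one).trans he
  have hr0 : 0 < r := by linarith
  have hlog : 1 ≤ Real.log r := (Real.le_log_iff_exp_le hr0).2 he
  set F : ℝ → ℝ := fun t => maxRe Q (circleMap 0 r t) -
    Real.log ‖expSum Q A (circleMap 0 r t)‖ with hF
  have hFm : Measurable F :=
    ((continuous_maxRe Q).comp (continuous_circleMap 0 r)).measurable.sub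
      (Real.measurable_log.comp
        ((continuous_expSum Q A).comp (continuous_circleMap 0 r)).norm.measurable)
  set μ := MeasureTheory.volume.restrict (Set.Ioc 0 (2 * Real.pi)) with hμ
  have hμu : μ Set.univ ≤ ENNReal.ofReal (2 * Real.pi) := by
    rw [hμ, MeasureTheory.Measure.restrict_apply_univ, Real.volume_Ioc, sub_zero]
  -- With `η = e^{-l/K}` the factor `η^K` is `e^{-l}`, and the factor `r^{-K}` accounts for the
  -- subtracted `K log r`.
  obtain ⟨hgi, hgle⟩ := integral_le_of_measure_lt_le_exp μ
    (fun t => max 0 (F t - K * Real.log r)) (by fun_prop) (fun t => le_max_left _ _)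
    (2 * Real.pi) (r ^ (K + 1)) K (by positivity) (one_le_pow₀ h1) hK0 hμu (fun l hl => by
      refine (MeasureTheory.measure_mono ?_).trans (hr (Real.exp (-l / K)) (Real.exp_pos _)
        (Real.exp_le_one_iff.2 (div_nonpos_of_nonpos_of_nonneg (by linarith) hK0.le)))
      intro t ht
      have ht' : l < F t - K * Real.log r := by
        rcases lt_max_iff.1 (show l < max 0 (F t - K * Real.log r) from ht) with h | h
        · linarith
        · exact h
      have hexp : Real.exp (-l / K) ^ K = Real.exp (-l) := by
        rw [← Real.exp_nat_mul]
        congr 1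
        field_simp
      change ‖_‖ < _
      rw [hexp]
      -- At a zero the logarithm has the default value `0`, but such a point lies in the sublevel
      -- set anyway.
      rcases eq_or_ne (expSum Q A (circleMap 0 r t)) 0 with h0 | h0
      · rw [h0, norm_zero]
        positivity
      · have hpos := norm_pos_iff.2 h0
        rw [← Real.log_lt_log_iff hpos (by positivity), Real.log_mul (by positivity) (by positivity),
          Real.log_mul (by positivity) (by positivity), Real.log_exp, Real.log_exp, Real.log_inv,
          Real.log_pow]
        simp only [hF] at ht'
        linarith)
  have hle : ∀ t, max 0 (F t) ≤ max 0 (F t - K * Real.log r) + K * Real.log r := by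
    intro t
    refine max_le (by positivity) ?_
    linarith [le_max_right 0 (F t - K * Real.log r)]
  have hconst : MeasureTheory.Integrable (fun _ : ℝ => K * Real.log r) μ :=
    (MeasureTheory.integrable_const_iff.2 (Or.inr ⟨hμu.trans_lt ENNReal.ofReal_lt_top⟩))
  have hint : MeasureTheory.Integrable (fun t => max 0 (F t)) μ := by
    refine (hgi.add hconst).mono' (by fun_prop) (Eventually.of_forall fun t => ?_)
    rw [Real.norm_of_nonneg (le_max_left _ _)]
    exact hle t
  constructor
  · rw [circleIntegrable_def, intervalIntegrable_iff_integrableOn_Ioc_of_le (by positivity)]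
    exact hint
  · rw [Real.circleAverage_def, intervalIntegral.integral_of_le (by positivity), smul_eq_mul]
    have h2 : ∫ t, max 0 (F t) ∂μ ≤
        2 * Real.pi * (K * Real.log (r ^ (K + 1))) + K + 2 * Real.pi * (K * Real.log r) := by
      calc ∫ t, max 0 (F t) ∂μ
          ≤ ∫ t, (max 0 (F t - K * Real.log r) + K * Real.log r) ∂μ :=
            MeasureTheory.integral_mono hint (hgi.add hconst) hle
        _ = ∫ t, max 0 (F t - K * Real.log r) ∂μ + 2 * Real.pi * (K * Real.log r) := by
            rw [MeasureTheory.integral_add hgi hconst, MeasureTheory.integral_const, hμ]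
            simp [Real.pi_pos.le]
        _ ≤ _ := by gcongr
    rw [Real.log_pow] at h2
    push_cast at h2
    calc (2 * Real.pi)⁻¹ * ∫ t, max 0 (F t) ∂μ
        ≤ (2 * Real.pi)⁻¹ * ((2 * Real.pi * (K * (K + 1)) + K + 2 * Real.pi * K) *
            Real.log r) := by
          gcongr
          nlinarith
      _ = _ := by
          field_simp

end ExpSum

/-! ### Sides, support function and Cauchy's formula. -/

section Circumference

/-- Multiplication by `conj c` scales the orientation determinant by `|c|²`. The direction `c` can
therefore serve as the horizontal axis. -/
theorem im_conj_sub_mul_sub (a b x c : ℂ) :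
    (conj (b - a) * (x - a)).im * Complex.normSq c =
      ((b * conj c).re - (a * conj c).re) * ((x * conj c).im - (a * conj c).im) -
      ((b * conj c).im - (a * conj c).im) * ((x * conj c).re - (a * conj c).re) := by
  simp only [Complex.mul_re, Complex.mul_im, Complex.sub_re, Complex.sub_im, Complex.conj_re,
    Complex.conj_im, Complex.normSq_apply]
  ring

/-- The three points are collinear and `a`, `a'` lie on the same side of `b`. If distinct, one of
them would lie strictly between the other and `b`, contradicting extremality. -/
theorem eq_of_im_conj_sub_mul_sub_eq_zero {K : Set ℂ} {a a' b : ℂ}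
    (ha : a ∈ K.extremePoints ℝ) (ha' : a' ∈ K.extremePoints ℝ) (hb : b ∈ K)
    (h0 : (conj (b - a) * (a' - a)).im = 0) {c : ℂ}
    (hpos : 0 < ((b * conj c).re - (a * conj c).re) * ((b * conj c).re - (a' * conj c).re)) :
    a = a' := by
  have hba : b - a ≠ 0 := by
    intro h
    rw [sub_eq_zero] at h
    simp [h] at hpos
  obtain ⟨t, ht⟩ : ∃ t : ℝ, a' - a = t * (b - a) := by
    refine ⟨(conj (b - a) * (a' - a)).re / Complex.normSq (b - a), ?_⟩
    have h1 : ((conj (b - a) * (a' - a)).re : ℂ) = conj (b - a) * (a' - a) :=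
      Complex.ext (by simp) (by rw [h0, Complex.ofReal_im])
    have h2 : (Complex.normSq (b - a) : ℂ) ≠ 0 := by
      exact_mod_cast (Complex.normSq_pos.2 hba).ne'
    rw [Complex.ofReal_div, h1, div_mul_eq_mul_div, eq_div_iff h2, ← Complex.mul_conj]
    ring
  have ha'e : a' = a + t * (b - a) := by rw [← ht]; ring
  have hpa : (b * conj c).re - (a' * conj c).re =
      (1 - t) * ((b * conj c).re - (a * conj c).re) := by
    rw [ha'e]
    simp only [Complex.mul_re, Complex.add_re, Complex.add_im, Complex.mul_im, Complex.sub_re,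
      Complex.sub_im, Complex.ofReal_re, Complex.ofReal_im]
    ring
  rw [hpa] at hpos
  have ht1 : t < 1 := by
    by_contra! h
    nlinarith [sq_nonneg ((b * conj c).re - (a * conj c).re)]
  rcases lt_trichotomy t 0 with h | h | h
  · have hmem : a ∈ openSegment ℝ a' b := by
      refine ⟨1 / (1 - t), -t / (1 - t), div_pos one_pos (by linarith),
        div_pos (by linarith) (by linarith), ?_, ?_⟩
      · rw [← add_div, ← sub_eq_add_neg, div_self (by linarith)]
      · have : (1 - t : ℂ) ≠ 0 := by
          rw [← Complex.ofReal_one, ← Complex.ofReal_sub]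
          exact_mod_cast (by linarith : (1 - t) ≠ 0)
        simp only [Complex.real_smul, ha'e]
        push_cast
        field_simp
        ring
    exact (ha.2 ha'.1 hb hmem).symm
  · rw [ha'e, h]; simp
  · have hmem : a' ∈ openSegment ℝ a b := by
      refine ⟨1 - t, t, by linarith, h, by ring, ?_⟩
      simp only [Complex.real_smul, ha'e]
      push_cast
      ring
    exact ha'.2 ha.1 hb hmem

/-- Among the segments joining an extreme point left of the vertical line at `s` to one right of it,
a segment crossing the line at the lowest height is a side. An extreme point below it would give a
lower crossing. -/
theorem exists_crossing_side {K : Set ℂ} (hfin : (K.extremePoints ℝ).Finite)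
    (hK : K = convexHull ℝ (K.extremePoints ℝ)) {c : ℂ} (hc : c ≠ 0) {s : ℝ}
    (hs : ∀ x ∈ K.extremePoints ℝ, (x * conj c).re ≠ s)
    (hlo : ∃ x ∈ K.extremePoints ℝ, (x * conj c).re < s)
    (hhi : ∃ x ∈ K.extremePoints ℝ, s < (x * conj c).re) :
    ∃ e ∈ polygonSides K, (e.1 * conj c).re < s ∧ s < (e.2 * conj c).re := by
  set p : ℂ → ℝ := fun x => (x * conj c).re with hp
  set y : ℂ → ℝ := fun x => (x * conj c).im with hy
  have hN : 0 < Complex.normSq c := Complex.normSq_pos.2 hc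
  set S : Set (ℂ × ℂ) := {e | (e.1 ∈ K.extremePoints ℝ ∧ e.2 ∈ K.extremePoints ℝ) ∧
    p e.1 < s ∧ s < p e.2} with hS
  have hSfin : S.Finite := (hfin.prod hfin).subset fun e he => he.1
  have hSne : S.Nonempty := by
    obtain ⟨x, hx, hxs⟩ := hlo
    obtain ⟨x', hx', hxs'⟩ := hhi
    exact ⟨(x, x'), ⟨hx, hx'⟩, hxs, hxs'⟩
  obtain ⟨⟨a, b⟩, ⟨⟨ha, hb⟩, has, hbs⟩, hmin⟩ := Set.exists_min_image S
    (fun e => (y e.1 * (p e.2 - s) + y e.2 * (s - p e.1)) / (p e.2 - p e.1)) hSfin hSne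
  simp only at ha hb has hbs hmin
  refine ⟨(a, b), ⟨ha, hb, ?_, ?_⟩, has, hbs⟩
  · intro h
    simp only at h
    rw [h] at has
    exact lt_asymm has hbs
  have hext : ∀ x ∈ K.extremePoints ℝ, 0 ≤ (conj (b - a) * (x - a)).im := by
    intro x hx
    have hcr := im_conj_sub_mul_sub a b x c
    change _ = (p b - p a) * (y x - y a) - (y b - y a) * (p x - p a) at hcr
    refine nonneg_of_mul_nonneg_left (b := Complex.normSq c) ?_ hN
    rw [hcr]
    rcases lt_or_gt_of_ne (hs x hx) with h | h
    · have h1 := hmin (x, b) ⟨⟨hx, hb⟩, h, hbs⟩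
      change p x < s at h
      simp only at h1
      rw [div_le_div_iff₀ (by linarith) (by linarith)] at h1
      refine nonneg_of_mul_nonneg_right (a := p b - s) ?_ (by linarith)
      linarith
    · have h1 := hmin (a, x) ⟨⟨ha, hx⟩, has, h⟩
      change s < p x at h
      simp only at h1
      rw [div_le_div_iff₀ (by linarith) (by linarith)] at h1
      refine nonneg_of_mul_nonneg_right (a := s - p a) ?_ (by linarith)
      linarith
  intro x hx
  have hconv : Convex ℝ {x : ℂ | 0 ≤ (conj (b - a) * (x - a)).im} := by
    have : {x : ℂ | 0 ≤ (conj (b - a) * (x - a)).im} =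
        {x : ℂ | (conj (b - a) * a).im ≤ (conj (b - a) * x).im} := by
      ext x
      simp only [Set.mem_ofPred_eq, mul_sub, Complex.sub_im, sub_nonneg]
    rw [this]
    refine convex_halfSpace_ge (IsLinearMap.mk (fun x y => ?_) fun t x => ?_) _
    · rw [mul_add, Complex.add_im]
    · simp only [Complex.real_smul, smul_eq_mul, mul_left_comm, Complex.im_ofReal_mul]
  rw [hK] at hx
  exact convexHull_min hext hconv hx

theorem crossing_side_unique {K : Set ℂ} {c : ℂ} {s : ℝ} {e e' : ℂ × ℂ}
    (he : e ∈ polygonSides K) (he' : e' ∈ polygonSides K)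
    (h₁ : (e.1 * conj c).re < s) (h₂ : s < (e.2 * conj c).re)
    (h₁' : (e'.1 * conj c).re < s) (h₂' : s < (e'.2 * conj c).re) : e = e' := by
  obtain ⟨a, b⟩ := e
  obtain ⟨a', b'⟩ := e'
  obtain ⟨ha, hb, -, hab⟩ := he
  obtain ⟨ha', hb', -, hab'⟩ := he'
  simp only at *
  have hN : 0 < Complex.normSq c := by
    refine Complex.normSq_pos.2 ?_
    rintro rfl
    simp only [map_zero, mul_zero, Complex.zero_re] at h₁ h₂
    linarith
  have i1 := hab a' ha'.1
  have i2 := hab b' hb'.1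
  have i3 := hab' a ha.1
  have i4 := hab' b hb.1
  have e1 := im_conj_sub_mul_sub a b a' c
  have e2 := im_conj_sub_mul_sub a b b' c
  have e3 := im_conj_sub_mul_sub a' b' a c
  have e4 := im_conj_sub_mul_sub a' b' b c
  -- Each side lies on or above the line through the other, so both cross at the same height.
  -- Algebraically, four nonnegative determinants with positive weights sum to zero and hence all
  -- vanish.
  have hsum : ((b' * conj c).re - s) * ((conj (b - a) * (a' - a)).im * Complex.normSq c) +
      (s - (a' * conj c).re) * ((conj (b - a) * (b' - a)).im * Complex.normSq c) +
      (((b * conj c).re - s) * ((conj (b' - a') * (a - a')).im * Complex.normSq c) +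
      (s - (a * conj c).re) * ((conj (b' - a') * (b - a')).im * Complex.normSq c)) = 0 := by
    rw [e1, e2, e3, e4]
    ring
  have j1 : 0 ≤ ((b' * conj c).re - s) * ((conj (b - a) * (a' - a)).im * Complex.normSq c) :=
    mul_nonneg (by linarith) (mul_nonneg i1 hN.le)
  have j2 : 0 ≤ (s - (a' * conj c).re) * ((conj (b - a) * (b' - a)).im * Complex.normSq c) :=
    mul_nonneg (by linarith) (mul_nonneg i2 hN.le)
  have j3 : 0 ≤ ((b * conj c).re - s) * ((conj (b' - a') * (a - a')).im * Complex.normSq c) :=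
    mul_nonneg (by linarith) (mul_nonneg i3 hN.le)
  have j4 : 0 ≤ (s - (a * conj c).re) * ((conj (b' - a') * (b - a')).im * Complex.normSq c) :=
    mul_nonneg (by linarith) (mul_nonneg i4 hN.le)
  have z1 : (conj (b - a) * (a' - a)).im = 0 := by
    have h : ((b' * conj c).re - s) * ((conj (b - a) * (a' - a)).im * Complex.normSq c) = 0 := by
      linarith
    rcases mul_eq_zero.1 h with h | h
    · linarith
    · exact (mul_eq_zero.1 h).resolve_right hN.ne'
  have z2 : (conj (b - a) * (b' - a)).im = 0 := by
    have h : (s - (a' * conj c).re) * ((conj (b - a) * (b' - a)).im * Complex.normSq c) = 0 := by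
      linarith
    rcases mul_eq_zero.1 h with h | h
    · linarith
    · exact (mul_eq_zero.1 h).resolve_right hN.ne'
  have z3 : (conj (a - b) * (b' - b)).im = 0 := by
    have h : (conj (a - b) * (b' - b)).im = -(conj (b - a) * (b' - a)).im := by
      simp only [Complex.mul_im, Complex.sub_re, Complex.sub_im, Complex.conj_re, Complex.conj_im]
      ring
    rw [h, z2, neg_zero]
  have hA := eq_of_im_conj_sub_mul_sub_eq_zero ha ha' hb.1 z1 (c := c)
    (mul_pos (by linarith) (by linarith))
  have hB := eq_of_im_conj_sub_mul_sub_eq_zero hb hb' ha.1 z3 (c := c)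
    (mul_pos_of_neg_of_neg (by linarith) (by linarith))
  rw [hA, hB]

variable {ι : Type*} [Fintype ι]

theorem finite_extremePoints_convexHull_range (u : ι → ℂ) :
    ((convexHull ℝ (Set.range u)).extremePoints ℝ).Finite :=
  (Set.finite_range u).subset extremePoints_convexHull_subset

theorem convexHull_extremePoints_convexHull_range (u : ι → ℂ) :
    convexHull ℝ (Set.range u) =
      convexHull ℝ ((convexHull ℝ (Set.range u)).extremePoints ℝ) := by
  have h := closure_convexHull_extremePoints ((Set.finite_range u).isCompact_convexHull ℝ)
    (convex_convexHull ℝ (Set.range u))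
  rw [IsClosed.closure_eq] at h
  · exact h.symm
  · exact (finite_extremePoints_convexHull_range u).isClosed_convexHull ℝ

variable [Nonempty ι]

/-- The support function of a finite family of points. -/
noncomputable def supportFun (u : ι → ℂ) (c : ℂ) : ℝ :=
  Finset.univ.sup' Finset.univ_nonempty fun j => (u j * conj c).re

theorem le_supportFun (u : ι → ℂ) (c : ℂ) (j : ι) : (u j * conj c).re ≤ supportFun u c :=
  Finset.le_sup' (fun j => (u j * conj c).re) (Finset.mem_univ j)

theorem continuous_supportFun (u : ι → ℂ) : Continuous (supportFun u) := by
  refine Continuous.finset_sup'_apply _ fun j _ => ?_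
  fun_prop

theorem exists_extremePoint_eq_supportFun (u : ι → ℂ) (c : ℂ) :
    ∃ x ∈ (convexHull ℝ (Set.range u)).extremePoints ℝ, (x * conj c).re = supportFun u c := by
  set E := (convexHull ℝ (Set.range u)).extremePoints ℝ with hE
  have hne : E.Nonempty := by
    by_contra h
    rw [Set.not_nonempty_iff_eq_empty] at h
    have := convexHull_extremePoints_convexHull_range u
    rw [← hE, h, convexHull_empty] at this
    exact (Set.range_nonempty u).convexHull.ne_empty this
  obtain ⟨x, hx, hmax⟩ := Set.exists_max_image E (fun x => (x * conj c).re)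
    (finite_extremePoints_convexHull_range u) hne
  refine ⟨x, hx, le_antisymm ?_ ?_⟩
  · obtain ⟨j, rfl⟩ := extremePoints_convexHull_subset hx
    exact le_supportFun u c j
  · refine Finset.sup'_le _ _ fun j _ => ?_
    have hconv : Convex ℝ {z : ℂ | (z * conj c).re ≤ (x * conj c).re} := by
      refine convex_halfSpace_le (IsLinearMap.mk (fun x y => ?_) fun t x => ?_) _
      · rw [add_mul, Complex.add_re]
      · simp only [Complex.real_smul, smul_eq_mul, mul_assoc, Complex.re_ofReal_mul]
    have hj : u j ∈ convexHull ℝ E := by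
      rw [← convexHull_extremePoints_convexHull_range]
      exact subset_convexHull ℝ _ (Set.mem_range_self j)
    exact convexHull_min hmax hconv hj

theorem re_mul_conj_le_supportFun (u : ι → ℂ) (c : ℂ) {x : ℂ}
    (hx : x ∈ (convexHull ℝ (Set.range u)).extremePoints ℝ) :
    (x * conj c).re ≤ supportFun u c := by
  obtain ⟨j, rfl⟩ := extremePoints_convexHull_subset hx
  exact le_supportFun u c j

theorem neg_supportFun_neg_le (u : ι → ℂ) (c : ℂ) {x : ℂ}
    (hx : x ∈ (convexHull ℝ (Set.range u)).extremePoints ℝ) :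
    -supportFun u (-c) ≤ (x * conj c).re := by
  have := re_mul_conj_le_supportFun u (-c) hx
  rw [map_neg, mul_neg, Complex.neg_re] at this
  linarith

open MeasureTheory in
/-- The width of a polygon is the sum of the projections of the sides that point in the given
direction. -/
theorem sum_polygonSides_eq_width (u : ι → ℂ) {c : ℂ} (hc : c ≠ 0) :
    ∑ e ∈ (finite_polygonSides (Set.finite_range u)).toFinset,
      max 0 ((e.2 - e.1) * conj c).re = supportFun u c + supportFun u (-c) := by
  set K := convexHull ℝ (Set.range u) with hK
  set T := (finite_polygonSides (Set.finite_range u)).toFinset with hT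
  have hmem : ∀ e, e ∈ T ↔ e ∈ polygonSides K := fun e => Set.Finite.mem_toFinset _
  obtain ⟨xM, hxM, hM⟩ := exists_extremePoint_eq_supportFun u c
  obtain ⟨xm, hxm, hm⟩ := exists_extremePoint_eq_supportFun u (-c)
  rw [map_neg, mul_neg, Complex.neg_re] at hm
  have hvol : ∀ a b : ℝ, ∫ s, (Set.Ioo a b).indicator (1 : ℝ → ℝ) s = max 0 (b - a) := by
    intro a b
    rw [integral_indicator_one measurableSet_Ioo, measureReal_def, Real.volume_Ioo,
      ENNReal.toReal_ofReal', max_comm]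
  have hint : ∀ a b : ℝ, Integrable ((Set.Ioo a b).indicator (1 : ℝ → ℝ)) := fun a b =>
    (integrable_indicator_iff measurableSet_Ioo).2
      (integrableOn_const (by rw [Real.volume_Ioo]; exact ENNReal.ofReal_ne_top))
  -- Almost every line `s` within the width is crossed from left to right by exactly one side, and
  -- lines outside by none. Integration over `s` gives the identity.
  have hae : (fun s => ∑ e ∈ T,
        (Set.Ioo (e.1 * conj c).re (e.2 * conj c).re).indicator (1 : ℝ → ℝ) s) =ᵐ[volume]
      (Set.Ioo (-supportFun u (-c)) (supportFun u c)).indicator 1 := by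
    have hnull : ∀ᵐ s : ℝ, s ∉ (fun x => (x * conj c).re) '' K.extremePoints ℝ :=
      ((finite_extremePoints_convexHull_range u).image _).countable.ae_notMem _
    filter_upwards [hnull] with s hs
    have hs' : ∀ x ∈ K.extremePoints ℝ, (x * conj c).re ≠ s := fun x hx h => hs ⟨x, hx, h⟩
    by_cases hsI : s ∈ Set.Ioo (-supportFun u (-c)) (supportFun u c)
    · obtain ⟨e, he, h1, h2⟩ := exists_crossing_side (finite_extremePoints_convexHull_range u)
        (convexHull_extremePoints_convexHull_range u) hc hs'
        ⟨xm, hxm, by linarith [hsI.1]⟩ ⟨xM, hxM, by linarith [hsI.2]⟩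
      rw [Set.indicator_of_mem hsI, Finset.sum_eq_single_of_mem e ((hmem e).2 he),
        Set.indicator_of_mem (show s ∈ Set.Ioo _ _ from ⟨h1, h2⟩)]
      · intro e' he' hne
        refine Set.indicator_of_notMem (fun h => hne ?_) _
        exact crossing_side_unique ((hmem e').1 he') he h.1 h.2 h1 h2
    · rw [Set.indicator_of_notMem hsI]
      refine Finset.sum_eq_zero fun e he => Set.indicator_of_notMem (fun h => hsI ?_) _
      have he' := (hmem e).1 he
      exact ⟨(neg_supportFun_neg_le u c he'.1).trans_lt h.1,
        h.2.trans_le (re_mul_conj_le_supportFun u c he'.2.1)⟩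
  have h := integral_congr_ae hae
  rw [integral_finsetSum _ fun e _ => hint _ _, hvol, sub_neg_eq_add, max_eq_right] at h
  · rw [← h]
    refine Finset.sum_congr rfl fun e _ => ?_
    rw [hvol, sub_mul, Complex.sub_re]
  · have := neg_supportFun_neg_le u c hxM
    linarith

theorem integral_max_zero_cos : ∫ t in (-(Real.pi / 2))..(-(Real.pi / 2) + 2 * Real.pi),
    max 0 (Real.cos t) = 2 := by
  have hcont : Continuous fun t => max 0 (Real.cos t) := by fun_prop
  rw [← intervalIntegral.integral_add_adjacent_intervals (b := Real.pi / 2)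
    (hcont.intervalIntegrable _ _) (hcont.intervalIntegrable _ _)]
  have h1 : ∫ t in (-(Real.pi / 2))..(Real.pi / 2), max 0 (Real.cos t) =
      ∫ t in (-(Real.pi / 2))..(Real.pi / 2), Real.cos t := by
    refine intervalIntegral.integral_congr fun t ht => ?_
    rw [Set.uIcc_of_le (by linarith [Real.pi_pos])] at ht
    exact max_eq_right (Real.cos_nonneg_of_mem_Icc ht)
  have h2 : ∫ t in (Real.pi / 2)..(-(Real.pi / 2) + 2 * Real.pi), max 0 (Real.cos t) =
      ∫ t in (Real.pi / 2)..(-(Real.pi / 2) + 2 * Real.pi), (0 : ℝ) := by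
    refine intervalIntegral.integral_congr fun t ht => ?_
    rw [Set.uIcc_of_le (by linarith [Real.pi_pos])] at ht
    exact max_eq_left (Real.cos_nonpos_of_pi_div_two_le_of_le ht.1 (by linarith [ht.2]))
  rw [h1, h2, integral_cos, intervalIntegral.integral_zero, Real.sin_neg, Real.sin_pi_div_two]
  norm_num

theorem integral_max_zero_re_mul_conj_circleMap (v : ℂ) :
    ∫ t in (0 : ℝ)..(2 * Real.pi), max 0 (v * conj (circleMap 0 1 t)).re = 2 * ‖v‖ := by
  have h : ∀ t : ℝ, max 0 (v * conj (circleMap 0 1 t)).re =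
      ‖v‖ * max 0 (Real.cos (t - v.arg)) := by
    intro t
    have : (v * conj (circleMap 0 1 t)).re = ‖v‖ * Real.cos (t - v.arg) := by
      conv_lhs => rw [← Complex.norm_mul_exp_arg_mul_I v]
      rw [circleMap, zero_add, Complex.ofReal_one, one_mul, ← Complex.exp_conj, mul_assoc,
        ← Complex.exp_add, map_mul, Complex.conj_I, Complex.conj_ofReal, mul_neg, ← sub_eq_add_neg,
        ← sub_mul, ← Complex.ofReal_sub, Complex.re_ofReal_mul, Complex.exp_ofReal_mul_I_re,
        ← Real.cos_neg, neg_sub]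
    rw [this, mul_max_of_nonneg _ _ (norm_nonneg v), mul_zero]
  simp_rw [h]
  have hper : Function.Periodic (fun t => max 0 (Real.cos t)) (2 * Real.pi) := fun t => by
    simp only [Real.cos_add_two_pi]
  rw [intervalIntegral.integral_const_mul,
    intervalIntegral.integral_comp_sub_right (fun t => max 0 (Real.cos t)), zero_sub,
    sub_eq_neg_add (2 * Real.pi),
    hper.intervalIntegral_add_eq (-v.arg) (-(Real.pi / 2)), integral_max_zero_cos, mul_comm]

/-- **Cauchy's formula**: the circumference of a convex polygon is the integral of its support
function. -/
theorem integral_supportFun_circleMap (u : ι → ℂ) :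
    ∫ t in (0 : ℝ)..(2 * Real.pi), supportFun u (circleMap 0 1 t) =
      circumference (convexHull ℝ (Set.range u)) := by
  set T := (finite_polygonSides (Set.finite_range u)).toFinset with hT
  have hc : circumference (convexHull ℝ (Set.range u)) = ∑ e ∈ T, dist e.1 e.2 :=
    finsum_mem_eq_finite_toFinset_sum _ _
  have hcont : Continuous fun t => supportFun u (circleMap 0 1 t) :=
    (continuous_supportFun u).comp (continuous_circleMap 0 1)
  have hcont' : Continuous fun t => supportFun u (-circleMap 0 1 t) :=
    (continuous_supportFun u).comp (continuous_circleMap 0 1).neg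
  have hneg : ∀ t, -circleMap 0 1 t = circleMap 0 1 (t + Real.pi) := by
    intro t
    simp [circleMap, add_mul, Complex.exp_add]
  have hper : Function.Periodic (fun t => supportFun u (circleMap 0 1 t)) (2 * Real.pi) :=
    fun t => by simp only [periodic_circleMap 0 1 t]
  have hshift : ∫ t in (0 : ℝ)..(2 * Real.pi), supportFun u (-circleMap 0 1 t) =
      ∫ t in (0 : ℝ)..(2 * Real.pi), supportFun u (circleMap 0 1 t) := by
    simp_rw [hneg]
    rw [intervalIntegral.integral_comp_add_right (fun t => supportFun u (circleMap 0 1 t)),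
      zero_add, add_comm (2 * Real.pi), hper.intervalIntegral_add_eq Real.pi 0, zero_add]
  -- Integrate the width identity over all directions. Each side contributes twice its length, and
  -- the two support functions have equal integrals.
  have hsum : ∑ e ∈ T, 2 * ‖e.2 - e.1‖ =
      2 * ∫ t in (0 : ℝ)..(2 * Real.pi), supportFun u (circleMap 0 1 t) := by
    calc ∑ e ∈ T, 2 * ‖e.2 - e.1‖
        = ∑ e ∈ T, ∫ t in (0 : ℝ)..(2 * Real.pi),
            max 0 ((e.2 - e.1) * conj (circleMap 0 1 t)).re :=
          Finset.sum_congr rfl fun e _ => (integral_max_zero_re_mul_conj_circleMap _).symm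
      _ = ∫ t in (0 : ℝ)..(2 * Real.pi), ∑ e ∈ T,
            max 0 ((e.2 - e.1) * conj (circleMap 0 1 t)).re := by
          refine (intervalIntegral.integral_finsetSum fun e _ =>
            Continuous.intervalIntegrable ?_ _ _).symm
          have := continuous_circleMap 0 1
          fun_prop
      _ = ∫ t in (0 : ℝ)..(2 * Real.pi),
            (supportFun u (circleMap 0 1 t) + supportFun u (-circleMap 0 1 t)) := by
          refine intervalIntegral.integral_congr fun t _ => ?_
          exact sum_polygonSides_eq_width u (circleMap_ne_center one_ne_zero)
      _ = _ := by
          rw [intervalIntegral.integral_add (hcont.intervalIntegrable _ _)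
            (hcont'.intervalIntegrable _ _), hshift, ← two_mul]
  rw [← Finset.mul_sum] at hsum
  rw [hc, ← mul_left_cancel₀ two_ne_zero hsum]
  exact Finset.sum_congr rfl fun e _ => by rw [dist_comm, dist_eq_norm]

end Circumference

/-! ### Jensen's formula, proximity function and the mean of `maxRe`. -/

section ExpSum

theorem circleIntegrable_zero_of_continuous {g : ℂ → ℝ} (hg : Continuous g) (r : ℝ) :
    CircleIntegrable g 0 r :=
  (hg.comp (continuous_circleMap 0 r)).intervalIntegrable _ _

variable {ι : Type*} [Fintype ι]

theorem differentiable_expSum (Q A : ι → ℂ[X]) : Differentiable ℂ (expSum Q A) :=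
  Differentiable.fun_sum fun j _ => (A j).differentiable.mul (Q j).differentiable.cexp

theorem meromorphic_expSum (Q A : ι → ℂ[X]) : Meromorphic (expSum Q A) :=
  fun z => ((differentiable_expSum Q A).analyticAt z).meromorphicAt

/-- The counting function of the zeros of an entire function in terms of circle averages. -/
theorem logCounting_inv_top_eq_of_differentiable {f : ℂ → ℂ} (hf : Differentiable ℂ f) {r : ℝ}
    (hr : r ≠ 0) : ValueDistribution.logCounting f⁻¹ ⊤ r =
      Real.circleAverage (fun z => Real.log ‖f z‖) 0 r -
        Real.log ‖meromorphicTrailingCoeffAt f 0‖ := by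
  have hmero : Meromorphic f := fun z => (hf.analyticAt z).meromorphicAt
  have htop : ValueDistribution.logCounting f ⊤ = 0 := by
    have h0 : Meromorphic (0 : ℂ → ℂ) := fun z => MeromorphicAt.const 0 z
    have h := ValueDistribution.logCounting_add_analyticOn h0
      (fun z _ => (hf.analyticAt z).analyticWithinAt : AnalyticOn ℂ f Set.univ)
    rw [zero_add] at h
    rw [h]
    exact ValueDistribution.logCounting_const (𝕜 := ℂ) (c := (0 : ℂ))
  have h := ValueDistribution.logCounting_zero_sub_logCounting_top_eq_circleAverage_sub_const
    hmero hr
  rw [htop, sub_zero] at h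
  rw [ValueDistribution.logCounting_inv, h]

variable [Nonempty ι]

open MeasureTheory in
-- Zeros lie in the sublevel set for every `η`, whose measure tends to `0` with `η`. They must be
-- excluded from the upper bound for `log |f|`, because the default value `log 0 = 0` may violate
-- it.
theorem eventually_ae_expSum_ne_zero (Q A : ι → ℂ[X])
    (hQ : ∀ i j, i ≠ j → 1 ≤ (Q i - Q j).natDegree) (hA : ∀ j, A j ≠ 0) :
    ∀ᶠ r : ℝ in atTop, ∀ᵐ t ∂volume.restrict (Set.Ioc 0 (2 * Real.pi)),
      expSum Q A (circleMap 0 r t) ≠ 0 := by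
  obtain ⟨K, -, hK⟩ := exists_volume_Ioc_expSum_lt_le Q A hQ hA
  filter_upwards [hK, eventually_gt_atTop 0] with r hr h0
  rw [ae_iff]
  refine le_antisymm (ENNReal.le_of_forall_pos_le_add fun ε hε _ => ?_) zero_le
  rw [zero_add]
  have hη : 0 < min 1 ((ε : ℝ) / r ^ (K + 1)) := lt_min one_pos (div_pos hε (by positivity))
  refine (measure_mono fun t ht => ?_).trans ((hr _ hη (min_le_left _ _)).trans ?_)
  · have ht0 : expSum Q A (circleMap 0 r t) = 0 := not_not.1 ht
    change ‖_‖ < _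
    rw [ht0, norm_zero]
    positivity
  · rw [← ENNReal.ofReal_coe_nnreal]
    refine ENNReal.ofReal_le_ofReal ?_
    calc r ^ (K + 1) * min 1 ((ε : ℝ) / r ^ (K + 1))
        ≤ r ^ (K + 1) * ((ε : ℝ) / r ^ (K + 1)) := by gcongr; exact min_le_right _ _
      _ = ε := by field_simp

/-- The circle averages of `log |f|` and of `max Re Qⱼ` differ by `O(log r)`. -/
theorem exists_abs_circleAverage_log_sub_le (Q A : ι → ℂ[X])
    (hQ : ∀ i j, i ≠ j → 1 ≤ (Q i - Q j).natDegree) (hA : ∀ j, A j ≠ 0) :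
    ∃ B : ℝ, ∀ᶠ r : ℝ in atTop,
      |Real.circleAverage (fun z => Real.log ‖expSum Q A z‖) 0 r -
        Real.circleAverage (maxRe Q) 0 r| ≤ B * Real.log r := by
  obtain ⟨B, hB⟩ := exists_circleAverage_maxRe_sub_log_le Q A hQ hA
  obtain ⟨K, hK⟩ := exists_norm_expSum_le Q A
  refine ⟨max B K, ?_⟩
  filter_upwards [hB, hK, eventually_ae_expSum_ne_zero Q A hQ hA, eventually_ge_atTop 1]
    with r ⟨hint, hle⟩ hub hae h1
  have hr0 : 0 < r := by linarith
  have hlog : 0 ≤ Real.log r := Real.log_nonneg h1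
  have hfi : CircleIntegrable (fun z => Real.log ‖expSum Q A z‖) 0 r :=
    MeromorphicOn.circleIntegrable_log_norm fun z _ => meromorphic_expSum Q A z
  have hmi := circleIntegrable_zero_of_continuous (continuous_maxRe Q) r
  have h2 : Real.circleAverage (maxRe Q) 0 r ≤
      Real.circleAverage (fun z => Real.log ‖expSum Q A z‖) 0 r + B * Real.log r := by
    refine le_trans ?_ (add_le_add_right hle _)
    rw [← Real.circleAverage_fun_add hfi hint]
    refine Real.circleAverage_mono hmi (hfi.add hint) fun z _ => ?_
    linarith [le_max_right 0 (maxRe Q z - Real.log ‖expSum Q A z‖)]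
  have h3 : Real.circleAverage (fun z => Real.log ‖expSum Q A z‖) 0 r ≤
      Real.circleAverage (maxRe Q) 0 r + K * Real.log r := by
    have hci : CircleIntegrable (fun _ => K * Real.log r) 0 r :=
      circleIntegrable_zero_of_continuous continuous_const r
    rw [← Real.circleAverage_const (K * Real.log r) 0 r, ← Real.circleAverage_fun_add hmi hci,
      Real.circleAverage_def, Real.circleAverage_def,
      intervalIntegral.integral_of_le (by positivity),
      intervalIntegral.integral_of_le (by positivity), smul_eq_mul, smul_eq_mul]
    refine mul_le_mul_of_nonneg_left (MeasureTheory.integral_mono_ae ?_ ?_ ?_) (by positivity)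
    · rw [circleIntegrable_def, intervalIntegrable_iff_integrableOn_Ioc_of_le (by positivity)]
        at hfi
      exact hfi
    · have := hmi.add hci
      rw [circleIntegrable_def, intervalIntegrable_iff_integrableOn_Ioc_of_le (by positivity)]
        at this
      exact this
    · filter_upwards [hae] with t ht
      have hpos := norm_pos_iff.2 ht
      have h4 := Real.log_le_log hpos
        (hub (circleMap 0 r t) (by rw [norm_circleMap_zero, abs_of_pos hr0]))
      rw [Real.log_mul (by positivity) (by positivity), Real.log_exp, Real.log_pow] at h4
      linarith
  have h5 : B * Real.log r ≤ max B K * Real.log r := by gcongr; exact le_max_left _ _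
  have h6 : K * Real.log r ≤ max B K * Real.log r := by gcongr; exact le_max_right _ _
  rw [abs_le]
  constructor <;> linarith

/-- An upper bound of the proximity function of `1/f`, where `f` is an exponential sum. -/
theorem exists_proximity_inv_le (Q A : ι → ℂ[X])
    (hQ : ∀ i j, i ≠ j → 1 ≤ (Q i - Q j).natDegree) (hA : ∀ j, A j ≠ 0) :
    ∃ B : ℝ, ∀ᶠ r : ℝ in atTop, ∀ D : ℝ, 0 ≤ D → (∀ z, ‖z‖ = r → -D ≤ maxRe Q z) →
      ValueDistribution.proximity (expSum Q A)⁻¹ ⊤ r ≤ B * Real.log r + D := by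
  obtain ⟨B, hB⟩ := exists_circleAverage_maxRe_sub_log_le Q A hQ hA
  refine ⟨B, ?_⟩
  filter_upwards [hB, eventually_ge_atTop 0] with r ⟨hint, hle⟩ h0 D hD0 hD
  have hci : CircleIntegrable (fun _ => D) 0 r :=
    circleIntegrable_zero_of_continuous continuous_const r
  refine le_trans ?_ (add_le_add_left hle D)
  rw [ValueDistribution.proximity_top]
  conv_rhs => rw [← Real.circleAverage_const D 0 r]
  rw [← Real.circleAverage_fun_add hint hci]
  refine Real.circleAverage_mono
    (MeromorphicOn.circleIntegrable_posLog_norm fun z _ => (meromorphic_expSum Q A).inv z)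
    (hint.add hci) fun z hz => ?_
  rw [mem_sphere_zero_iff_norm, abs_of_nonneg h0] at hz
  rw [Real.posLog_apply, Pi.inv_apply, norm_inv, Real.log_inv]
  have h1 := hD z hz
  have h2 := le_max_left 0 (maxRe Q z - Real.log ‖expSum Q A z‖)
  have h3 := le_max_right 0 (maxRe Q z - Real.log ‖expSum Q A z‖)
  exact max_le (by linarith) (by linarith)

/-- The largest real part of the exponents in terms of the support function of the conjugate
leading coefficients. -/
theorem exists_abs_maxRe_sub_supportFun_le (Q : ι → ℂ[X]) (q m : ℕ)
    (hdeg : ∀ j, (Q j - C ((Q j).coeff q) * X ^ q).natDegree ≤ m) :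
    ∃ B : ℝ, 0 ≤ B ∧ ∀ r : ℝ, 1 ≤ r → ∀ t : ℝ, |maxRe Q (circleMap 0 r t) -
      r ^ q * supportFun (fun j => conj ((Q j).coeff q)) (circleMap 0 1 (q * t))| ≤ B * r ^ m := by
  choose b hb0 hb using fun j => exists_norm_eval_le (Q j - C ((Q j).coeff q) * X ^ q)
  refine ⟨∑ j, b j, Finset.sum_nonneg fun j _ => hb0 j, fun r hr t => ?_⟩
  have hr0 : 0 < r := by linarith
  set c := circleMap 0 1 (q * t) with hc
  have hpow : circleMap 0 r t ^ q = (r ^ q : ℝ) * c := by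
    rw [hc, circleMap, circleMap, zero_add, zero_add, mul_pow, ← Complex.exp_nat_mul]
    push_cast
    rw [one_mul]
    ring_nf
  have key : ∀ j, |((Q j).eval (circleMap 0 r t)).re -
      r ^ q * (conj ((Q j).coeff q) * conj c).re| ≤ (∑ j, b j) * r ^ m := by
    intro j
    have hn : ‖circleMap 0 r t‖ = r := by rw [norm_circleMap_zero, abs_of_pos hr0]
    have h1 := hb j (circleMap 0 r t) (by rw [hn]; exact hr)
    rw [hn, eval_sub, eval_mul, eval_C, eval_pow, eval_X, hpow] at h1
    have h2 : ((Q j).eval (circleMap 0 r t)).re - r ^ q * (conj ((Q j).coeff q) * conj c).re =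
        ((Q j).eval (circleMap 0 r t) - (Q j).coeff q * ((r ^ q : ℝ) * c)).re := by
      rw [← map_mul, Complex.conj_re, Complex.sub_re, mul_left_comm, Complex.re_ofReal_mul]
    rw [h2]
    refine (Complex.abs_re_le_norm _).trans (h1.trans ?_)
    gcongr
    · exact Finset.sum_nonneg fun j _ => hb0 j
    · exact Finset.single_le_sum (fun j _ => hb0 j) (Finset.mem_univ j)
    · exact hdeg j
  have hrq : 0 < r ^ q := by positivity
  rw [abs_le]
  constructor
  · have h3 : supportFun (fun j => conj ((Q j).coeff q)) c ≤
        (maxRe Q (circleMap 0 r t) + (∑ j, b j) * r ^ m) / r ^ q := by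
      refine Finset.sup'_le _ _ fun j _ => ?_
      rw [le_div_iff₀ hrq]
      have h4 := (abs_le.1 (key j)).1
      have h5 := le_maxRe Q j (circleMap 0 r t)
      linarith
    rw [le_div_iff₀ hrq] at h3
    linarith
  · obtain ⟨j, hj⟩ := exists_eq_maxRe Q (circleMap 0 r t)
    have h4 := (abs_le.1 (key j)).2
    have h5 := mul_le_mul_of_nonneg_left
      (le_supportFun (fun j => conj ((Q j).coeff q)) c j) hrq.le
    rw [hj]
    linarith

/-- The direction `qt` runs `q` times around the circle, which cancels the factor `1/q` of the
substitution. -/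
theorem integral_supportFun_circleMap_mul (u : ι → ℂ) {q : ℕ} (hq : q ≠ 0) :
    ∫ t in (0 : ℝ)..(2 * Real.pi), supportFun u (circleMap 0 1 (q * t)) =
      circumference (convexHull ℝ (Set.range u)) := by
  have hq' : (q : ℝ) ≠ 0 := Nat.cast_ne_zero.2 hq
  have hcont : Continuous fun t => supportFun u (circleMap 0 1 t) :=
    (continuous_supportFun u).comp (continuous_circleMap 0 1)
  have hper : Function.Periodic (fun t => supportFun u (circleMap 0 1 t)) (2 * Real.pi) :=
    fun t => by simp only [periodic_circleMap 0 1 t]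
  have h := hper.intervalIntegral_add_zsmul_eq q 0 fun _ _ => hcont.intervalIntegrable _ _
  rw [zero_add, zero_add, integral_supportFun_circleMap, zsmul_eq_mul, zsmul_eq_mul,
    Int.cast_natCast] at h
  rw [intervalIntegral.integral_comp_mul_left (fun t => supportFun u (circleMap 0 1 t)) hq',
    mul_zero, h, smul_eq_mul, inv_mul_cancel_left₀ hq']

theorem exists_abs_circleAverage_maxRe_sub_le (Q : ι → ℂ[X]) {q : ℕ} (hq : q ≠ 0) (m : ℕ)
    (hdeg : ∀ j, (Q j - C ((Q j).coeff q) * X ^ q).natDegree ≤ m) :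
    ∃ B : ℝ, 0 ≤ B ∧ ∀ r : ℝ, 1 ≤ r → |Real.circleAverage (maxRe Q) 0 r -
      circumference (convexHull ℝ (Set.range fun j => conj ((Q j).coeff q))) * r ^ q /
        (2 * Real.pi)| ≤ B * r ^ m := by
  obtain ⟨B, hB0, hB⟩ := exists_abs_maxRe_sub_supportFun_le Q q m hdeg
  refine ⟨B, hB0, fun r hr => ?_⟩
  set u := fun j => conj ((Q j).coeff q) with hu
  have hc1 : Continuous fun t => maxRe Q (circleMap 0 r t) :=
    (continuous_maxRe Q).comp (continuous_circleMap 0 r)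
  have hc2 : Continuous fun t : ℝ => r ^ q * supportFun u (circleMap 0 1 (q * t)) :=
    continuous_const.mul ((continuous_supportFun u).comp
      ((continuous_circleMap 0 1).comp (by fun_prop)))
  have h1 : Real.circleAverage (maxRe Q) 0 r -
      circumference (convexHull ℝ (Set.range u)) * r ^ q / (2 * Real.pi) =
      (2 * Real.pi)⁻¹ * ∫ t in (0 : ℝ)..(2 * Real.pi), (maxRe Q (circleMap 0 r t) -
        r ^ q * supportFun u (circleMap 0 1 (q * t))) := by
    rw [intervalIntegral.integral_sub (hc1.intervalIntegrable _ _) (hc2.intervalIntegrable _ _),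
      intervalIntegral.integral_const_mul, integral_supportFun_circleMap_mul u hq,
      Real.circleAverage_def, smul_eq_mul]
    ring
  have h2 := intervalIntegral.norm_integral_le_of_norm_le_const (a := 0) (b := 2 * Real.pi)
    (f := fun t => maxRe Q (circleMap 0 r t) - r ^ q * supportFun u (circleMap 0 1 (q * t)))
    (C := B * r ^ m) fun t _ => hB r hr t
  rw [sub_zero, abs_of_pos Real.two_pi_pos, Real.norm_eq_abs] at h2
  rw [h1, abs_mul, abs_of_pos (inv_pos.2 Real.two_pi_pos), inv_mul_le_iff₀ Real.two_pi_pos]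
  linarith

end ExpSum

/-! ### Normalized exponents and the theorem. -/

namespace ExponentialPolynomial

variable {n : ℕ} (f : ExponentialPolynomial n)

/-- By the normalization `Q_j(0) = 0`, a constant difference would be zero. -/
theorem one_le_natDegree_Q_sub_Q {i j : Fin (n + 1)} (hij : i ≠ j) :
    1 ≤ (f.Q i - f.Q j).natDegree := by
  by_contra h
  obtain ⟨c, hc⟩ := natDegree_eq_zero.1 (by omega : (f.Q i - f.Q j).natDegree = 0)
  have h0 : (f.Q i - f.Q j).eval 0 = 0 := by
    rw [eval_sub, f.Q_eval_zero, f.Q_eval_zero, sub_zero]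
  rw [← hc, eval_C] at h0
  rw [h0, C_0] at hc
  exact hij (f.Q_injective (sub_eq_zero.1 hc.symm))

/-- Subtracting the common `w z^q` leaves the differences of the exponents nonconstant, so the terms
of a group cannot cancel. -/
theorem H_ne_zero_iff (w : ℂ) : f.H w ≠ 0 ↔ (f.group w).Nonempty := by
  constructor
  · intro h
    by_contra hne
    refine h (funext fun z => ?_)
    rw [H, Finset.not_nonempty_iff_eq_empty.1 hne, Finset.sum_empty, Pi.zero_apply]
  · rintro ⟨i, hi⟩ h
    refine expSum_ne_zero (ι := f.group w) (fun j => f.Q j - C w * X ^ f.order) (fun j => f.P j)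
      (fun i j hij => ?_) ⟨i, hi⟩ (f.P_ne_zero i) ?_
    · rw [sub_sub_sub_cancel_right]
      exact f.one_le_natDegree_Q_sub_Q fun h => hij (Subtype.ext h)
    · rw [← h]
      funext z
      exact Finset.sum_coe_sort (f.group w) fun j =>
        (f.P j).eval z * Complex.exp ((f.Q j - C w * X ^ f.order).eval z)

theorem W_eq_range : f.W = Set.range fun j => conj ((f.Q j).coeff f.order) := by
  have h : {w | f.H w ≠ 0} = Set.range fun j => (f.Q j).coeff f.order := by
    ext w
    rw [Set.mem_ofPred_eq, H_ne_zero_iff]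
    simp [Finset.Nonempty, group]
  rw [W, h, ← Set.range_comp]
  rfl

end ExponentialPolynomial

theorem theorem3p2 {n : ℕ} (f : ExponentialPolynomial n) (p : ℕ) (hp : 1 ≤ p) (hpq : p ≤ f.order)
    (hH : ∀ w : ℂ, f.orderH w ≤ f.order - p) :
    (f.H 0 ≠ 0 →
      ValueDistribution.proximity (f.toFun)⁻¹ ⊤ =O[atTop]
        fun r : ℝ => r ^ (f.order - p) + Real.log r) ∧
    ((∃ j, f.Q j = 0) →
      ValueDistribution.proximity (f.toFun)⁻¹ ⊤ =O[atTop] Real.log) ∧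
    (fun r : ℝ => ValueDistribution.logCounting (f.toFun)⁻¹ ⊤ r -
        circumference (convexHull ℝ f.W) * r ^ f.order / (2 * Real.pi)) =O[atTop]
      fun r : ℝ => r ^ (f.order - p) + Real.log r := by
  have hQ : ∀ i j, i ≠ j → 1 ≤ (f.Q i - f.Q j).natDegree :=
    fun i j => f.one_le_natDegree_Q_sub_Q
  have hf : f.toFun = expSum f.Q f.P := rfl
  have hdeg : ∀ j, (f.Q j - C ((f.Q j).coeff f.order) * X ^ f.order).natDegree ≤ f.order - p :=
    fun j => (Finset.le_sup (f := fun i =>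
      (f.Q i - C ((f.Q j).coeff f.order) * X ^ f.order).natDegree)
      (show j ∈ f.group ((f.Q j).coeff f.order) from
        Finset.mem_filter.2 ⟨Finset.mem_univ j, rfl⟩)).trans (hH _)
  obtain ⟨B, hB⟩ := exists_proximity_inv_le f.Q f.P hQ f.P_ne_zero
  rw [hf]
  refine ⟨fun h0 => ?_, fun ⟨j, hj⟩ => ?_, ?_⟩
  · obtain ⟨j, hj⟩ := (f.H_ne_zero_iff 0).1 h0
    -- For `w = 0` nothing is subtracted, so `Q j` itself has degree at most `q - p` and bounds `M`
    -- below by `-b r^{q-p}`.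
    have hj0 : (f.Q j).coeff f.order = 0 := (Finset.mem_filter.1 hj).2
    have hd := hdeg j
    rw [hj0, C_0, zero_mul, sub_zero] at hd
    obtain ⟨b, hb0, hb⟩ := exists_norm_eval_le (f.Q j)
    refine IsBigO.of_bound (max B b) ?_
    filter_upwards [hB, eventually_ge_atTop 1] with r hr h1
    have hlog : 0 ≤ Real.log r := Real.log_nonneg h1
    rw [Real.norm_of_nonneg (ValueDistribution.proximity_nonneg r),
      Real.norm_of_nonneg (by positivity)]
    refine (hr (b * r ^ (f.order - p)) (by positivity) fun z hz => ?_).trans ?_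
    · refine le_trans ?_ (le_maxRe f.Q j z)
      have h2 := hb z (by rw [hz]; exact h1)
      have h3 := (abs_le.1 (Complex.abs_re_le_norm ((f.Q j).eval z))).1
      have h4 : b * ‖z‖ ^ (f.Q j).natDegree ≤ b * r ^ (f.order - p) := by
        rw [hz]
        gcongr
      linarith
    · have h5 : B * Real.log r ≤ max B b * Real.log r := by gcongr; exact le_max_left _ _
      have h6 : b * r ^ (f.order - p) ≤ max B b * r ^ (f.order - p) := by
        gcongr
        exact le_max_right _ _
      linarith
  · refine IsBigO.of_bound B ?_
    filter_upwards [hB, eventually_ge_atTop 1] with r hr h1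
    rw [Real.norm_of_nonneg (ValueDistribution.proximity_nonneg r),
      Real.norm_of_nonneg (Real.log_nonneg h1)]
    refine (hr 0 le_rfl fun z _ => ?_).trans_eq (add_zero _)
    refine le_trans ?_ (le_maxRe f.Q j z)
    simp [hj]
  · obtain ⟨B₁, hB₁⟩ := exists_abs_circleAverage_log_sub_le f.Q f.P hQ f.P_ne_zero
    obtain ⟨B₂, hB₂0, hB₂⟩ := exists_abs_circleAverage_maxRe_sub_le f.Q
      (by omega : f.order ≠ 0) (f.order - p) hdeg
    rw [← f.W_eq_range] at hB₂
    set L := Real.log ‖meromorphicTrailingCoeffAt (expSum f.Q f.P) 0‖ with hL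
    refine IsBigO.of_bound (max B₁ (B₂ + |L|)) ?_
    filter_upwards [hB₁, eventually_ge_atTop 1] with r hr h1
    have hlog : 0 ≤ Real.log r := Real.log_nonneg h1
    rw [logCounting_inv_top_eq_of_differentiable (differentiable_expSum f.Q f.P)
      (by linarith : r ≠ 0), Real.norm_of_nonneg (by positivity : 0 ≤ r ^ (f.order - p) + _),
      Real.norm_eq_abs]
    have h2 := abs_le.1 hr
    have h3 := abs_le.1 (hB₂ r h1)
    have h4 := abs_le.1 (le_refl |L|)
    have h5 : B₁ * Real.log r ≤ max B₁ (B₂ + |L|) * Real.log r := by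
      gcongr
      exact le_max_left _ _
    have h6 : (B₂ + |L|) * r ^ (f.order - p) ≤ max B₁ (B₂ + |L|) * r ^ (f.order - p) := by
      gcongr
      exact le_max_right _ _
    -- The constant of Jensen's formula is absorbed by `r^{q-p} ≥ 1`.
    have h7 : |L| ≤ |L| * r ^ (f.order - p) :=
      le_mul_of_one_le_right (abs_nonneg L) (one_le_pow₀ h1)
    rw [abs_le]
    constructor <;> linarith
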